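/- Let $p$ be a prime, let $d, r$ be non-negative integers and let $\mathbb{C}_p$ be the completion of an algebraic closure of $\mathbb{Q}_p$. Let $\log_p$ denote the branch of the $p$-adic logarithm on $\mathbb{C}_p^*$ (and on $\mathbb{Q}_p^*$) with $\log_p(p) = 0$, that is, $\log_p z = \frac1m \sum_{k \ge 1} \frac{(-1)^{k-1}}{k} (z^m p^l - 1)^k$ for any integers $m \ge 1$ and $l$ with $|z^m p^l - 1|_p < 1$. Let $T_p^d = \{z \in \mathbb{C}_p^d : |z_i|_p = 1 \text{ for all } i\}$ be the $p$-adic $d$-torus. Let $f = \sum_{\nu \in \mathbb{Z}^d} a_\nu t^\nu$, with almost all $a_\nu \in M_r(\mathbb{Z})$ equal to zero, be an $r \times r$ matrix over $\mathbb{Z}[\mathbb{Z}^d] = \mathbb{Z}[t_1^{\pm 1}, \ldots, t_d^{\pm 1}]$ such that the matrix $f(z) \in M_r(\mathbb{C}_p)$ is invertible for every $z \in T_p^d$. Let $X_f$ be the group of all $x = (x_{\gamma})_{\gamma \in \mathbb{Z}^d}$ with $x_\gamma \in (\mathbb{R}/\mathbb{Z})^r$ (row vectors) and $$\sum_{\gamma'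 \in \mathbb{Z}^d} x_{\gamma'}\, a_{\gamma' - \gamma}^{\top} = 0 \quad \text{for all } \gamma \in \mathbb{Z}^d,$$ with the action of $\mathbb{Z}^d$ by $(\gamma x)_{\gamma'} = x_{\gamma' - \gamma}$. For $n \ge 1$ prime to $p$ let $\Gamma_n = (n\mathbb{Z})^d$; these are finite index subgroups of $\mathbb{Z}^d$, and only $0$ lies in infinitely many of them. Let $\mathrm{Fix}_{\Gamma_n}(X_f)$ be the set of points of $X_f$ fixed by $\Gamma_n$. Then $\mathrm{Fix}_{\Gamma_n}(X_f)$ is finite for every $n$ prime to $p$; the $p$-adic entropy $$h_p(f) = \lim_{\substack{n \to \infty \\ (n,p)=1}} \frac{1}{(\mathbb{Z}^d : \Gamma_n)} \log_p |\mathrm{Fix}_{\Gamma_n}(X_f)|$$ of the $\mathbb{Z}^d$-action on $X_f$ exists in $\mathbb{Q}_p$; the $p$-adic Mahler measure of $\det f$, given by the Snirelman integral $$m_p(\det f) = \int_{T_p^d} \log_p (\det f)(z) := \lim_{\substack{N \to \infty \\ (N,p)=1}} \frac{1}{N^d} \sum_{\zeta \in \mu_N^d} \log_p\big((\det f)(\zeta)\big),$$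 where $\mu_N$ is the group of $N$-th roots of unity, exists in $\mathbb{C}_p$; and $h_p(f) = m_p(\det f)$. -/

import Mathlib

open Filter Topology

noncomputable section

namespace PadicEntropy

/-! ### The `p`-adic logarithm -/

section Log

variable {K : Type*} [NormedField K]

/-- The logarithm series `log u = ∑_{k ≥ 1} (-1)^(k-1) (u - 1)^k / k`, used for `‖u - 1‖ < 1`. -/
def logSeries (u : K) : K :=
  ∑' k : ℕ, (-1) ^ k * (u - 1) ^ (k + 1) / ((k : K) + 1)

open Classical in
/-- The branch of the `p`-adic logarithm with `log_p p = 0`, on the nonzero elements of `ℚ_[p]` or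
of `ℂ_[p]`. Each nonzero `z` has `‖z ^ m * p ^ k - 1‖ < 1` for some integers `m ≥ 1` and `k`;
then `log_p z = (1 / m) * log (z ^ m * p ^ k)`, which does not depend on `m` and `k`.
By convention the value is `0` at `z = 0`. -/
def padicLog (p : ℕ) (z : K) : K :=
  if h : ∃ q : ℕ × ℤ, 0 < q.1 ∧ ‖z ^ q.1 * (p : K) ^ q.2 - 1‖ < 1 then
    ((h.choose.1 : ℕ) : K)⁻¹ * logSeries (z ^ h.choose.1 * (p : K) ^ h.choose.2)
  else 0

end Log

/-! ### `p`-adic entropy of a group action -/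

/-- `Γ_n → e`: the `Γ_n` are normal subgroups of finite index, and only the neutral element lies in
infinitely many of them. The groups are written additively; the index set `ι` is
typically an infinite set of natural numbers. -/
def TendsToTrivial {G ι : Type*} [AddGroup G] (N : ι → AddSubgroup G) : Prop :=
  (∀ n, (N n).Normal ∧ (N n).FiniteIndex) ∧ ∀ γ : G, γ ≠ 0 → {n | γ ∈ N n}.Finite

/-- The `p`-adic entropy of the action of `G` on the set `X` with respect to `Γ_n → e` exists and
equals `h`: the sets of fixed points `Fix_{Γ_n}(X)` are finite and
`h = lim_{n → ∞} (G : Γ_n)⁻¹ log_p |Fix_{Γ_n}(X)|`. -/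
structure HasPadicEntropy (p : ℕ) [Fact p.Prime] {G ι : Type*} [AddGroup G] [Preorder ι]
    (X : Type*) [AddAction G X] (N : ι → AddSubgroup G) (h : ℚ_[p]) : Prop where
  tendsToTrivial : TendsToTrivial N
  finite_fixedPoints : ∀ n, (AddAction.fixedPoints (N n) X).Finite
  pos_card : ∀ n, 0 < (AddAction.fixedPoints (N n) X).ncard
  tendsto : Tendsto
    (fun n => ((N n).index : ℚ_[p])⁻¹ *
      padicLog p ((AddAction.fixedPoints (N n) X).ncard : ℚ_[p])) atTop (𝓝 h)

/-- The subgroup `(nℤ)^d` of `ℤ^d`. -/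
def multiples (d n : ℕ) : AddSubgroup (Fin d → ℤ) :=
  AddSubgroup.pi Set.univ fun _ => AddSubgroup.zmultiples (n : ℤ)

/-! ### The algebraic `ℤ^d`-action defined by a matrix over `ℤ[ℤ^d]` -/

/-- The integral group ring `ℤ[ℤ^d] = ℤ[t₁^{±1}, …, t_d^{±1}]`. -/
abbrev Laurent (d : ℕ) : Type := AddMonoidAlgebra ℤ (Fin d → ℤ)

/-- The full shift `((ℝ/ℤ)^r)^(ℤ^d)`. -/
def FullShift (d r : ℕ) : Type := (Fin d → ℤ) → Fin r → UnitAddCircle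

instance (d r : ℕ) : AddCommGroup (FullShift d r) :=
  inferInstanceAs (AddCommGroup ((Fin d → ℤ) → Fin r → UnitAddCircle))

/-- The left shift action `(γ x)_{γ'} = x_{-γ + γ'}`. -/
instance (d r : ℕ) : AddAction (Fin d → ℤ) (FullShift d r) where
  vadd γ x := fun γ' => x (-γ + γ')
  zero_vadd x := by
    funext γ'
    change x (-0 + γ') = x γ'
    rw [neg_zero, zero_add]
  add_vadd γ δ x := by
    funext γ'
    change x (-(γ + δ) + γ') = x (-δ + (-γ + γ'))
    rw [neg_add_rev, add_assoc]

/-- For `f = ∑_ν a_ν t^ν` with integral `r × r` matrices `a_ν`, the subgroup `X_f` of the full shift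
of all `x` with `∑_{γ'} x_{γ'} (a_{γ' - γ})ᵀ = 0` in `(ℝ/ℤ)^r` for all `γ`, the `x_{γ'}` being row
vectors. The `j`-th coordinate of this sum, with `γ' = γ + ν`, is
`∑_i ∑_ν (a_ν)_{j i} x_{γ + ν, i}`. -/
def solutions {d r : ℕ} (f : Matrix (Fin r) (Fin r) (Laurent d)) :
    AddSubgroup (FullShift d r) where
  carrier := {x | ∀ (γ : Fin d → ℤ) (j : Fin r),
    ∑ i, ∑ ν ∈ (f j i).coeff.support, (f j i).coeff ν • x (γ + ν) i = 0}
  zero_mem' := by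
    intro γ j
    refine Finset.sum_eq_zero fun i _ => Finset.sum_eq_zero fun ν _ => ?_
    exact smul_zero _
  add_mem' := by
    intro x y hx hy γ j
    have h : ∀ (i : Fin r) (ν : Fin d → ℤ), (f j i).coeff ν • (x + y) (γ + ν) i =
        (f j i).coeff ν • x (γ + ν) i + (f j i).coeff ν • y (γ + ν) i := fun i ν => smul_add _ _ _
    simp only [h, Finset.sum_add_distrib, hx γ j, hy γ j, add_zero]
  neg_mem' := by
    intro x hx γ j
    have h : ∀ (i : Fin r) (ν : Fin d → ℤ), (f j i).coeff ν • (-x) (γ + ν) i =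
        -((f j i).coeff ν • x (γ + ν) i) := fun i ν => smul_neg _ _
    simp only [h, Finset.sum_neg_distrib, hx γ j, neg_zero]

theorem vadd_mem_solutions {d r : ℕ} {f : Matrix (Fin r) (Fin r) (Laurent d)} (δ : Fin d → ℤ)
    {x : FullShift d r} (hx : x ∈ solutions f) : δ +ᵥ x ∈ solutions f := by
  intro γ j
  have h := hx (-δ + γ) j
  simp only [add_assoc] at h
  exact h

/-- The restriction of the shift action to `X_f`. -/
instance {d r : ℕ} (f : Matrix (Fin r) (Fin r) (Laurent d)) :
    AddAction (Fin d → ℤ) (solutions f) where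
  vadd γ x := ⟨γ +ᵥ (x : FullShift d r), vadd_mem_solutions γ x.2⟩
  zero_vadd x := Subtype.ext (zero_vadd (Fin d → ℤ) (x : FullShift d r))
  add_vadd γ δ x := Subtype.ext (add_vadd γ δ (x : FullShift d r))

/-! ### The `p`-adic torus and the `p`-adic Mahler measure -/

/-- The `p`-adic `d`-torus `T_p^d = {z ∈ ℂ_p^d | |z_i|_p = 1 for all i}`. -/
def padicTorus (p d : ℕ) [Fact p.Prime] : Set (Fin d → ℂ_[p]) :=
  {z | ∀ i, ‖z i‖ = 1}

/-- The value `g(z) = ∑_ν a_ν ∏_i z_i^{ν_i}` of `g = ∑_ν a_ν t^ν` at a point `z` with nonzero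
coordinates. -/
def laurentEval {d : ℕ} {K : Type*} [Field K] (z : Fin d → K) (g : Laurent d) : K :=
  ∑ ν ∈ g.coeff.support, (g.coeff ν : K) * ∏ i, z i ^ ν i

/-- The Snirelman integral of `F` over `T_p^d` exists and equals `I`:
`I = lim N^{-d} ∑_{ζ ∈ μ_N^d} F(ζ)` as `N → ∞` with `(N, p) = 1`. Here `μ_N^d ⊆ T_p^d`, so only the
values of `F` on `T_p^d` matter. -/
def HasSnirelmanIntegral (p d : ℕ) [Fact p.Prime] (F : (Fin d → ℂ_[p]) → ℂ_[p])
    (I : ℂ_[p]) : Prop :=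
  Tendsto
    (fun N : {n : ℕ // n.Coprime p} => (((N : ℕ) : ℂ_[p]) ^ d)⁻¹ *
      ∑ ζ ∈ Fintype.piFinset fun _ : Fin d => Polynomial.nthRootsFinset (N : ℕ) (1 : ℂ_[p]), F ζ)
    atTop (𝓝 I)

/-- The `p`-adic Mahler measure `m_p(g) = ∫_{T_p^d} log_p g(z)` exists and equals `m`. -/
def HasPadicMahlerMeasure (p : ℕ) [Fact p.Prime] {d : ℕ} (g : Laurent d) (m : ℂ_[p]) : Prop :=
  HasSnirelmanIntegral p d (fun z => padicLog p (laurentEval z g)) m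

end PadicEntropy

end

/-! The points of `X_f` fixed by `(nℤ)^d` form the kernel of an integral matrix `A_n` on a
finite-dimensional real torus, so there are `|det A_n|` of them once this is nonzero
(`natCard_torusKernel`). The characters of `(ℤ/n)^d` block-diagonalize `A_n` with blocks `f(ζ)`, `ζ
∈ μ_n^d`; hence `det A_n = ∏ det f(ζ)` (`det_periodicMatrix`), nonzero by hypothesis. Taking
logarithms, the `n`-th entropy term equals the `n`-th Snirelman mean exactly
(`fixedPoints_and_padicLog_ncard`), so only one limit has to be shown to exist.

For that limit, a Laurent polynomial over `ℤ` without zeros on the `p`-adic torus is `p^k (c t^α + p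
g)` with `p ∤ c` (`exists_eq_of_forall_padicTorus`). At roots of unity the logarithm kills `p^k` and
`t^α` and leaves `log c + log (1 + (p/c) G(ζ))` with `G = t^(-α) g`. Averaging the log series term
by term gives terms that are eventually constant in `n` and uniformly bounded by a summable sequence
(`tendsto_tsum_meanTerm`). The limit lies in `ℚ_p` because `ℚ_p` is closed in `ℂ_p`.

Additivity of `padicLog` is proved only on `HasLog`, and membership there is checked just for the
numbers that occur; no structure theory of `ℂ_p^*` enters. -/

noncomputable section

namespace PadicEntropy

/-! ### Properties of the `p`-adic logarithm -/

section LogProperties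

variable {p : ℕ} [Fact p.Prime] {K : Type*} [NormedField K] [NormedAlgebra ℚ_[p] K]

include p in
variable (p K) in
theorem charZero_of_normedAlgebra_padic : CharZero K :=
  (RingHom.charZero_iff (algebraMap ℚ_[p] K).injective).mp inferInstance

variable (p) in
theorem norm_natCast_eq (n : ℕ) : ‖(n : K)‖ = ‖(n : ℚ_[p])‖ := by
  rw [← map_natCast (algebraMap ℚ_[p] K), norm_algebraMap']

variable (p) in
theorem norm_intCast_eq (n : ℤ) : ‖(n : K)‖ = ‖(n : ℚ_[p])‖ := by
  rw [← map_intCast (algebraMap ℚ_[p] K), norm_algebraMap']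

variable (p) in
include p in
theorem norm_natCast_le_one (n : ℕ) : ‖(n : K)‖ ≤ 1 := by
  rw [norm_natCast_eq p]
  exact_mod_cast Padic.norm_int_le_one (p := p) n

variable (p) in
include p in
theorem norm_intCast_le_one (n : ℤ) : ‖(n : K)‖ ≤ 1 := by
  rw [norm_intCast_eq p]
  exact Padic.norm_int_le_one n

variable (p K) in
theorem norm_prime_lt_one : ‖(p : K)‖ < 1 := by
  rw [norm_natCast_eq p]; exact Padic.norm_p_lt_one

variable (p K) in
theorem prime_ne_zero : (p : K) ≠ 0 := by
  have := charZero_of_normedAlgebra_padic p K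
  exact_mod_cast (Fact.out : p.Prime).ne_zero

-- The power of `p` dividing `k + 1` is at most `k + 1`. Thus the denominators of the log series
-- cost only a linear factor, which gives the dominating series used throughout.
variable (p K) in
include p in
theorem one_le_mul_norm_succ (k : ℕ) : 1 ≤ ((k : ℝ) + 1) * ‖((k : K) + 1)‖ := by
  have h : ‖((k : K) + 1)‖ = ‖((k + 1 : ℕ) : ℚ_[p])‖ := by
    rw [← norm_natCast_eq (K := K) p]; push_cast; rfl
  have hk : ((k + 1 : ℕ) : ℚ_[p]) ≠ 0 := by exact_mod_cast Nat.succ_ne_zero k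
  have hp : (0 : ℝ) < p := by exact_mod_cast (Fact.out : p.Prime).pos
  rw [h, Padic.norm_eq_zpow_neg_valuation hk, Padic.valuation_natCast, zpow_neg, zpow_natCast,
    ← div_eq_mul_inv, one_le_div (pow_pos hp _)]
  exact_mod_cast Nat.le_of_dvd (Nat.succ_pos k) pow_padicValNat_dvd

variable (p) in
include p in
theorem norm_div_succ_le (a : K) (k : ℕ) : ‖a / ((k : K) + 1)‖ ≤ ((k : ℝ) + 1) * ‖a‖ := by
  have := charZero_of_normedAlgebra_padic p K
  have h0 : (0 : ℝ) < ‖((k : K) + 1)‖ := norm_pos_iff.mpr (by exact_mod_cast Nat.succ_ne_zero k)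
  rw [norm_div, div_le_iff₀ h0]
  nlinarith [one_le_mul_norm_succ p K k, norm_nonneg a]

theorem summable_succ_mul_pow {x : ℝ} (h0 : 0 ≤ x) (h1 : x < 1) :
    Summable fun k : ℕ => ((k : ℝ) + 1) * x ^ (k + 1) := by
  have h := (summable_nat_add_iff 1).mpr
    (summable_pow_mul_geometric_of_norm_lt_one (R := ℝ) 1 (r := x) (by rwa [Real.norm_of_nonneg h0]))
  simpa using h

theorem norm_mul_sub_one_lt [IsUltrametricDist K] {u v : K} (hu : ‖u - 1‖ < 1)
    (hv : ‖v - 1‖ < 1) : ‖u * v - 1‖ < 1 := by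
  have h : u * v - 1 = (u - 1) * (v - 1) + ((u - 1) + (v - 1)) := by ring
  rw [h]
  refine (IsUltrametricDist.norm_add_le_max _ _).trans_lt (max_lt ?_ ?_)
  · rw [norm_mul]; nlinarith [norm_nonneg (u - 1), norm_nonneg (v - 1)]
  · exact (IsUltrametricDist.norm_add_le_max _ _).trans_lt (max_lt hu hv)

theorem norm_pow_sub_one_lt [IsUltrametricDist K] {u : K} (hu : ‖u - 1‖ < 1) (n : ℕ) :
    ‖u ^ n - 1‖ < 1 := by
  induction n with
  | zero => simp
  | succ n ih => rw [pow_succ]; exact norm_mul_sub_one_lt ih hu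

theorem norm_eq_one_of_norm_sub_one_lt [IsUltrametricDist K] {u : K} (hu : ‖u - 1‖ < 1) :
    ‖u‖ = 1 := by
  have h := IsUltrametricDist.norm_add_eq_max_of_norm_ne_norm (x := u - 1) (y := 1)
    (by rw [norm_one]; exact hu.ne)
  rw [sub_add_cancel, norm_one, max_eq_right hu.le] at h
  exact h

variable (p K) in
theorem tendsto_prime_pow : Tendsto (fun n : ℕ => (p : K) ^ n) atTop (𝓝 0) :=
  tendsto_pow_atTop_nhds_zero_of_norm_lt_one (norm_prime_lt_one p K)

-- Since `p^n - 1 → -1`, the limit is the binomial coefficient of `-1` over `k`. The induction is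
-- Pascal's rule, where `C(p^n, k+1) = p^n C(p^n - 1, k) / (k + 1)` tends to zero.
variable (p K) in
theorem tendsto_choose_prime_pow_sub_one (k : ℕ) :
    Tendsto (fun n : ℕ => ((p ^ n - 1).choose k : K)) atTop (𝓝 ((-1) ^ k)) := by
  have := charZero_of_normedAlgebra_padic p K
  have hpos : ∀ n, 0 < p ^ n := fun n => pow_pos (Fact.out : p.Prime).pos n
  induction k with
  | zero => simp
  | succ k ih =>
    have h0 : ((k : K) + 1) ≠ 0 := by exact_mod_cast Nat.succ_ne_zero k
    have h : ∀ n : ℕ, ((p ^ n - 1).choose (k + 1) : K) =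
        (p : K) ^ n * ((p ^ n - 1).choose k : K) / ((k : K) + 1) - ((p ^ n - 1).choose k : K) := by
      intro n
      obtain ⟨m, hm⟩ := Nat.exists_eq_succ_of_ne_zero (hpos n).ne'
      have e1 : ((m : K) + 1) * (m.choose k : K) = ((m + 1).choose (k + 1) : K) * ((k : K) + 1) := by
        exact_mod_cast Nat.add_one_mul_choose_eq m k
      have e2 : ((m + 1).choose (k + 1) : K) = m.choose k + m.choose (k + 1) := by
        exact_mod_cast Nat.choose_succ_succ m k
      have e3 : (p : K) ^ n = (m : K) + 1 := by exact_mod_cast hm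
      rw [hm, Nat.succ_sub_one, e3, e1, mul_div_cancel_right₀ _ h0, e2]
      ring
    simp only [h]
    have := (((tendsto_prime_pow p K).mul ih).div_const ((k : K) + 1)).sub ih
    simpa [pow_succ] using this

/-- Expand `(1 + (u - 1))^(p^n)` and use `C(p^n, k+1) / p^n = C(p^n - 1, k) / (k + 1)`; dominated
convergence then applies termwise. This limit formula replaces power series identities in the proofs
of the functional equation and of compatibility with field extensions. -/
theorem tendsto_logSeries [CompleteSpace K] {u : K} (hu : ‖u - 1‖ < 1) :
    Tendsto (fun n : ℕ => (u ^ p ^ n - 1) / (p : K) ^ n) atTop (𝓝 (logSeries u)) := by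
  have := charZero_of_normedAlgebra_padic p K
  have hpos : ∀ n, 0 < p ^ n := fun n => pow_pos (Fact.out : p.Prime).pos n
  have key : ∀ n : ℕ, (u ^ p ^ n - 1) / (p : K) ^ n =
      ∑' k : ℕ, ((p ^ n - 1).choose k : K) * (u - 1) ^ (k + 1) / ((k : K) + 1) := by
    intro n
    obtain ⟨m, hm⟩ := Nat.exists_eq_succ_of_ne_zero (hpos n).ne'
    have e3 : (p : K) ^ n = (m : K) + 1 := by exact_mod_cast hm
    have h1 : ((m : K) + 1) ≠ 0 := by exact_mod_cast Nat.succ_ne_zero m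
    rw [tsum_eq_sum (s := Finset.range (m + 1))]
    · rw [e3, hm, Nat.succ_sub_one, div_eq_iff h1]
      have hexp : u ^ (m + 1) = ∑ k ∈ Finset.range (m + 2),
          (u - 1) ^ k * ((m + 1).choose k : K) := by
        conv_lhs => rw [← sub_add_cancel u 1, add_pow]
        simp
      rw [Nat.succ_eq_add_one, hexp, Finset.sum_range_succ', Finset.sum_mul]
      simp only [pow_zero, Nat.choose_zero_right, Nat.cast_one, mul_one, add_sub_cancel_right]
      refine Finset.sum_congr rfl fun k _ => ?_
      have h0 : ((k : K) + 1) ≠ 0 := by exact_mod_cast Nat.succ_ne_zero k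
      have e1 : ((m : K) + 1) * (m.choose k : K) =
          ((m + 1).choose (k + 1) : K) * ((k : K) + 1) := by
        exact_mod_cast Nat.add_one_mul_choose_eq m k
      rw [div_mul_eq_mul_div, eq_div_iff h0]
      linear_combination -(u - 1) ^ (k + 1) * e1
    · intro k hk
      rw [Finset.mem_range, not_lt] at hk
      rw [hm, Nat.choose_eq_zero_of_lt (by simpa using hk)]
      simp
  simp only [key, logSeries]
  refine tendsto_tsum_of_dominated_convergence
    (summable_succ_mul_pow (norm_nonneg (u - 1)) hu) (fun k => ?_) (Eventually.of_forall ?_)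
  · exact ((tendsto_choose_prime_pow_sub_one p K k).mul_const _).div_const _
  · intro n k
    refine (norm_div_succ_le p _ k).trans ?_
    rw [norm_mul, norm_pow]
    gcongr
    exact mul_le_of_le_one_left (by positivity) (norm_natCast_le_one p _)

variable [CompleteSpace K] [IsUltrametricDist K]

-- With `a = (u^(p^n) - 1) / p^n` and `b` likewise for `v`, the quotient for `u v` is `p^n a b + a +
-- b`, and the first summand vanishes in the limit.
variable (p) in
include p in
theorem logSeries_mul {u v : K} (hu : ‖u - 1‖ < 1) (hv : ‖v - 1‖ < 1) :
    logSeries (u * v) = logSeries u + logSeries v := by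
  have h1 := tendsto_logSeries (p := p) (norm_mul_sub_one_lt hu hv)
  have hu' := tendsto_logSeries (p := p) hu
  have hv' := tendsto_logSeries (p := p) hv
  have h2 := (((tendsto_prime_pow p K).mul hu').mul hv').add (hu'.add hv')
  rw [zero_mul, zero_mul, zero_add] at h2
  refine tendsto_nhds_unique h1 (h2.congr fun n => ?_)
  have h0 : (p : K) ^ n ≠ 0 := pow_ne_zero _ (prime_ne_zero p K)
  field_simp
  ring

omit [CompleteSpace K] [IsUltrametricDist K] in
theorem logSeries_one : logSeries (1 : K) = 0 := by
  simp [logSeries]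

variable (p) in
include p in
theorem logSeries_pow {u : K} (hu : ‖u - 1‖ < 1) (n : ℕ) :
    logSeries (u ^ n) = n * logSeries u := by
  induction n with
  | zero => simp [logSeries_one]
  | succ n ih =>
    rw [pow_succ, logSeries_mul p (norm_pow_sub_one_lt hu n) hu, ih]
    push_cast
    ring

/-- The pair `(m, k)` can be used to compute `padicLog p z`. -/
def LogData (p : ℕ) {K : Type*} [NormedField K] (z : K) (m : ℕ) (k : ℤ) : Prop :=
  0 < m ∧ ‖z ^ m * (p : K) ^ k - 1‖ < 1

/-- Independence of the chosen pair: raising each expression to the other's exponent gives `z^(m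
m')` times a power of `p`, both of norm one. Comparing norms forces `k m' = k' m`, so the two powers
coincide and `logSeries_pow` concludes. -/
theorem LogData.padicLog_eq {z : K} {m : ℕ} {k : ℤ} (h : LogData p z m k) :
    padicLog p z = (m : K)⁻¹ * logSeries (z ^ m * (p : K) ^ k) := by
  have := charZero_of_normedAlgebra_padic p K
  have hex : ∃ q : ℕ × ℤ, 0 < q.1 ∧ ‖z ^ q.1 * (p : K) ^ q.2 - 1‖ < 1 := ⟨(m, k), h⟩
  rw [padicLog, dif_pos hex]
  obtain ⟨hm', h'⟩ := hex.choose_spec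
  generalize hex.choose.1 = m' at *
  generalize hex.choose.2 = k' at *
  obtain ⟨hm, h⟩ := h
  have hp0 : (p : K) ≠ 0 := prime_ne_zero p K
  have e1 : (z ^ m * (p : K) ^ k) ^ m' = z ^ (m * m') * (p : K) ^ (k * m') := by
    rw [mul_pow, ← pow_mul, zpow_mul, zpow_natCast]
  have e2 : (z ^ m' * (p : K) ^ k') ^ m = z ^ (m * m') * (p : K) ^ (k' * m) := by
    rw [mul_pow, ← pow_mul, zpow_mul, zpow_natCast, mul_comm m']
  have n1 := norm_eq_one_of_norm_sub_one_lt (norm_pow_sub_one_lt h m')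
  have n2 := norm_eq_one_of_norm_sub_one_lt (norm_pow_sub_one_lt h' m)
  rw [e1, norm_mul] at n1
  rw [e2, norm_mul] at n2
  have hz : ‖z ^ (m * m')‖ ≠ 0 := fun h0 => by rw [h0, zero_mul] at n1; exact zero_ne_one n1
  have h3 : ‖(p : K) ^ (k * m')‖ = ‖(p : K) ^ (k' * m)‖ := mul_left_cancel₀ hz (n1.trans n2.symm)
  rw [norm_zpow, norm_zpow] at h3
  have h4 : k * m' = k' * m :=
    zpow_right_injective₀ (norm_pos_iff.mpr hp0) (norm_prime_lt_one p K).ne h3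
  have h5 := logSeries_pow p h m'
  rw [e1, h4, ← e2, logSeries_pow p h' m] at h5
  have hm0 : (m : K) ≠ 0 := by exact_mod_cast hm.ne'
  have hm0' : (m' : K) ≠ 0 := by exact_mod_cast hm'.ne'
  field_simp
  linear_combination h5

variable (p) in
/-- The domain on which `padicLog p` is given by its defining formula. -/
def HasLog (z : K) : Prop := ∃ m k, LogData p z m k

omit [NormedAlgebra ℚ_[p] K] [CompleteSpace K] [Fact p.Prime] in
theorem LogData.mul {z w : K} {m n : ℕ} {k l : ℤ} (hp : (p : K) ≠ 0) (hz : LogData p z m k)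
    (hw : LogData p w n l) : LogData p (z * w) (m * n) (k * n + l * m) ∧
      (z * w) ^ (m * n) * (p : K) ^ (k * n + l * m) =
        (z ^ m * (p : K) ^ k) ^ n * (w ^ n * (p : K) ^ l) ^ m := by
  have h : (z * w) ^ (m * n) * (p : K) ^ (k * n + l * m) =
        (z ^ m * (p : K) ^ k) ^ n * (w ^ n * (p : K) ^ l) ^ m := by
    rw [zpow_add₀ hp, zpow_mul, zpow_mul, zpow_natCast, zpow_natCast]
    ring
  refine ⟨⟨Nat.mul_pos hz.1 hw.1, ?_⟩, h⟩
  rw [h]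
  exact norm_mul_sub_one_lt (norm_pow_sub_one_lt hz.2 _) (norm_pow_sub_one_lt hw.2 _)

omit [CompleteSpace K] in
theorem HasLog.mul {z w : K} (hz : HasLog p z) (hw : HasLog p w) : HasLog p (z * w) := by
  obtain ⟨m, k, hz⟩ := hz
  obtain ⟨n, l, hw⟩ := hw
  exact ⟨_, _, (hz.mul (prime_ne_zero p K) hw).1⟩

theorem HasLog.padicLog_mul {z w : K} (hz : HasLog p z) (hw : HasLog p w) :
    padicLog p (z * w) = padicLog p z + padicLog p w := by
  have := charZero_of_normedAlgebra_padic p K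
  obtain ⟨m, k, hz⟩ := hz
  obtain ⟨n, l, hw⟩ := hw
  obtain ⟨h1, h2⟩ := hz.mul (prime_ne_zero p K) hw
  rw [h1.padicLog_eq, hz.padicLog_eq, hw.padicLog_eq, h2,
    logSeries_mul p (norm_pow_sub_one_lt hz.2 _) (norm_pow_sub_one_lt hw.2 _),
    logSeries_pow p hz.2, logSeries_pow p hw.2]
  have hm0 : (m : K) ≠ 0 := by exact_mod_cast hz.1.ne'
  have hm0' : (n : K) ≠ 0 := by exact_mod_cast hw.1.ne'
  push_cast
  field_simp

omit [NormedAlgebra ℚ_[p] K] [CompleteSpace K] [Fact p.Prime] [IsUltrametricDist K] in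
theorem logData_of_pow_eq_one {z : K} {m : ℕ} (hm : 0 < m) (h : z ^ m = 1) : LogData p z m 0 :=
  ⟨hm, by simp [h]⟩

omit [NormedAlgebra ℚ_[p] K] [CompleteSpace K] [Fact p.Prime] [IsUltrametricDist K] in
theorem hasLog_of_pow_eq_one {z : K} {m : ℕ} (hm : 0 < m) (h : z ^ m = 1) : HasLog p z :=
  ⟨m, 0, logData_of_pow_eq_one hm h⟩

theorem padicLog_of_pow_eq_one {z : K} {m : ℕ} (hm : 0 < m) (h : z ^ m = 1) :
    padicLog p z = 0 := by
  rw [(logData_of_pow_eq_one hm h).padicLog_eq]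
  simp [h, logSeries_one]

theorem padicLog_prod {ι : Type*} (s : Finset ι) (z : ι → K) (h : ∀ i ∈ s, HasLog p (z i)) :
    HasLog p (∏ i ∈ s, z i) ∧ padicLog p (∏ i ∈ s, z i) = ∑ i ∈ s, padicLog p (z i) := by
  classical
  induction s using Finset.induction_on with
  | empty =>
    simp only [Finset.prod_empty, Finset.sum_empty]
    exact ⟨hasLog_of_pow_eq_one one_pos (one_pow 1), padicLog_of_pow_eq_one one_pos (one_pow 1)⟩
  | insert a s ha ih =>
    obtain ⟨h1, h2⟩ := ih fun i hi => h i (Finset.mem_insert_of_mem hi)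
    have h3 := h a (Finset.mem_insert_self a s)
    rw [Finset.prod_insert ha, Finset.sum_insert ha, ← h2]
    exact ⟨h3.mul h1, h3.padicLog_mul h1⟩

omit [NormedAlgebra ℚ_[p] K] [CompleteSpace K] [Fact p.Prime] [IsUltrametricDist K] in
theorem logData_of_norm_sub_one_lt {u : K} (hu : ‖u - 1‖ < 1) : LogData p u 1 0 :=
  ⟨one_pos, by simpa using hu⟩

theorem padicLog_of_norm_sub_one_lt {u : K} (hu : ‖u - 1‖ < 1) : padicLog p u = logSeries u := by
  rw [(logData_of_norm_sub_one_lt hu).padicLog_eq]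
  simp

omit [CompleteSpace K] [IsUltrametricDist K] in
variable (p K) in
theorem logData_prime_pow (n : ℕ) : LogData p ((p : K) ^ n) 1 (-n) :=
  ⟨one_pos, by simp [mul_inv_cancel₀ (pow_ne_zero n (prime_ne_zero p K))]⟩

variable (p K) in
theorem padicLog_prime_pow (n : ℕ) : padicLog p ((p : K) ^ n) = 0 := by
  rw [(logData_prime_pow p K n).padicLog_eq]
  simp [mul_inv_cancel₀ (pow_ne_zero n (prime_ne_zero p K)), logSeries_one]

omit [CompleteSpace K] [IsUltrametricDist K] in
variable (K) in
theorem hasLog_intCast {c : ℤ} (hc : ¬(p : ℤ) ∣ c) : HasLog p (c : K) := by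
  -- The exponent `p - 1` works by Fermat's little theorem.
  refine ⟨p - 1, 0, Nat.sub_pos_of_lt (Fact.out : p.Prime).one_lt, ?_⟩
  have h : (p : ℤ) ∣ c ^ (p - 1) - 1 := by
    rw [← Int.modEq_iff_dvd]
    exact (Int.ModEq.pow_card_sub_one_eq_one (Fact.out : p.Prime)
      ((Int.isCoprime_iff_gcd_eq_one.mpr (Int.isCoprime_iff_gcd_eq_one.mp
        ((Nat.prime_iff_prime_int.mp (Fact.out : p.Prime)).coprime_iff_not_dvd.mpr hc))).symm)).symm
  have h2 := (Padic.norm_intCast_lt_one_iff (p := p)).mpr h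
  rw [← norm_intCast_eq (K := K) p] at h2
  simpa using h2

theorem logSeries_algebraMap {u : ℚ_[p]} (hu : ‖u - 1‖ < 1) :
    logSeries (algebraMap ℚ_[p] K u) = algebraMap ℚ_[p] K (logSeries u) := by
  have hu' : ‖algebraMap ℚ_[p] K u - 1‖ < 1 := by
    rwa [← map_one (algebraMap ℚ_[p] K), ← map_sub, norm_algebraMap']
  refine tendsto_nhds_unique (tendsto_logSeries (p := p) hu') ?_
  have h := ((algebraMapCLM ℚ_[p] K).continuous.tendsto _).comp (tendsto_logSeries (p := p) hu)
  refine h.congr fun n => ?_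
  simp

variable (K) in
theorem HasLog.padicLog_algebraMap {x : ℚ_[p]} (hx : HasLog p x) :
    padicLog p (algebraMap ℚ_[p] K x) = algebraMap ℚ_[p] K (padicLog p x) := by
  obtain ⟨m, k, h⟩ := hx
  have e : algebraMap ℚ_[p] K x ^ m * (p : K) ^ k =
      algebraMap ℚ_[p] K (x ^ m * (p : ℚ_[p]) ^ k) := by simp
  have h' : LogData p (algebraMap ℚ_[p] K x) m k := by
    refine ⟨h.1, ?_⟩
    rw [e, ← map_one (algebraMap ℚ_[p] K), ← map_sub, norm_algebraMap']
    exact h.2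
  rw [h.padicLog_eq, h'.padicLog_eq, e, logSeries_algebraMap h.2]
  simp

omit [CompleteSpace K] [IsUltrametricDist K] in
variable (K) in
theorem hasLog_of_hasLog_algebraMap {x : ℚ_[p]} (hx : HasLog p (algebraMap ℚ_[p] K x)) :
    HasLog p x := by
  obtain ⟨m, k, h⟩ := hx
  refine ⟨m, k, h.1, ?_⟩
  have h2 := h.2
  rwa [← map_natCast (algebraMap ℚ_[p] K) p, ← map_zpow₀, ← map_pow, ← map_mul,
    ← map_one (algebraMap ℚ_[p] K), ← map_sub, norm_algebraMap'] at h2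

end LogProperties

/-! ### Evaluation of Laurent polynomials -/

section Eval

variable {d : ℕ} {K : Type*} [Field K]

/-- The ring homomorphism `g ↦ g(z)` for a point `z` with nonzero coordinates. -/
def laurentHom (z : Fin d → K) (hz : ∀ i, z i ≠ 0) : Laurent d →+* K :=
  (AddMonoidAlgebra.lift ℤ K (Fin d → ℤ)
    { toFun := fun ν => ∏ i, z i ^ (Multiplicative.toAdd ν) i
      map_one' := by simp
      map_mul' := fun μ ν => by
        simp [zpow_add₀ (hz _), Finset.prod_mul_distrib] } : Laurent d →ₐ[ℤ] K).toRingHom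

theorem laurentHom_apply (z : Fin d → K) (hz : ∀ i, z i ≠ 0) (g : Laurent d) :
    laurentHom z hz g = laurentEval z g := by
  simp [laurentHom, AddMonoidAlgebra.lift_apply, Finsupp.sum, laurentEval]

theorem laurentHom_single (z : Fin d → K) (hz : ∀ i, z i ≠ 0) (ν : Fin d → ℤ) (c : ℤ) :
    laurentHom z hz (AddMonoidAlgebra.single ν c) = c * ∏ i, z i ^ ν i := by
  simp [laurentHom]

theorem map_laurentEval_eq {r : ℕ} (f : Matrix (Fin r) (Fin r) (Laurent d)) (z : Fin d → K)
    (hz : ∀ i, z i ≠ 0) : f.map (laurentEval z) = (laurentHom z hz).mapMatrix f := by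
  ext i j
  simp [laurentHom_apply]

theorem det_map_laurentEval {r : ℕ} (f : Matrix (Fin r) (Fin r) (Laurent d)) (z : Fin d → K)
    (hz : ∀ i, z i ≠ 0) : (f.map (laurentEval z)).det = laurentEval z f.det := by
  rw [map_laurentEval_eq f z hz, ← RingHom.map_det, laurentHom_apply]

end Eval

/-! ### Roots of norm one -/

section Roots

open Polynomial

variable {K : Type*} [NormedField K] [IsUltrametricDist K]

/-- Multiplying by `X - a` moves the strictly dominant coefficient from `k` to `k + 1` if `‖a‖ < 1`
and keeps it at `k` if `‖a‖ > 1`. So `k` counts the roots inside the unit disc, as in the Newton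
polygon. -/
theorem exists_dominant_coeff (s : Multiset K) (hs : ∀ a ∈ s, ‖a‖ ≠ 1) :
    ∃ k, ∀ i ≠ k, ‖((s.map fun a => X - C a).prod).coeff i‖ <
      ‖((s.map fun a => X - C a).prod).coeff k‖ := by
  induction s using Multiset.induction_on with
  | empty =>
    refine ⟨0, fun i hi => ?_⟩
    simp [coeff_one, hi]
  | cons a s ih =>
    obtain ⟨k, hk⟩ := ih fun b hb => hs b (Multiset.mem_cons_of_mem hb)
    have ha := hs a (Multiset.mem_cons_self a s)
    rw [Multiset.map_cons, Multiset.prod_cons]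
    set P := (s.map fun a => X - C a).prod
    have hle : ∀ i, ‖P.coeff i‖ ≤ ‖P.coeff k‖ := fun i => by
      rcases eq_or_ne i k with rfl | hi
      · exact le_rfl
      · exact (hk i hi).le
    have hpos : 0 < ‖P.coeff k‖ := (norm_nonneg _).trans_lt (hk (k + 1) (Nat.succ_ne_self k))
    have hsucc : ∀ i, ((X - C a) * P).coeff (i + 1) = P.coeff i - a * P.coeff (i + 1) := fun i => by
      rw [sub_mul, coeff_sub, coeff_X_mul, coeff_C_mul]
    have hzero : ((X - C a) * P).coeff 0 = -(a * P.coeff 0) := by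
      rw [sub_mul, coeff_sub, coeff_C_mul]
      simp
    have hsub : ∀ x y : K, ‖x - y‖ ≤ max ‖x‖ ‖y‖ := fun x y => by
      rw [sub_eq_add_neg, ← norm_neg y]
      exact IsUltrametricDist.norm_add_le_max x (-y)
    rcases lt_or_gt_of_ne ha with ha | ha
    · have hmul : ∀ i, ‖a * P.coeff i‖ < ‖P.coeff k‖ := fun i => by
        rw [norm_mul]
        nlinarith [hle i, norm_nonneg (P.coeff i), norm_nonneg a]
      have hdom : ‖((X - C a) * P).coeff (k + 1)‖ = ‖P.coeff k‖ := by
        rw [hsucc, sub_eq_add_neg, IsUltrametricDist.norm_add_eq_max_of_norm_ne_norm, norm_neg,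
          max_eq_left (hmul _).le]
        rw [norm_neg]
        exact (hmul _).ne'
      refine ⟨k + 1, fun i hi => ?_⟩
      rw [hdom]
      rcases i with _ | i
      · rw [hzero, norm_neg]
        exact hmul 0
      · rw [hsucc]
        exact (hsub _ _).trans_lt (max_lt (hk i (by omega)) (hmul _))
    · have hlt : ∀ i, ‖P.coeff i‖ < ‖a * P.coeff k‖ := fun i => by
        rw [norm_mul]
        nlinarith [hle i]
      have hmul : ∀ i ≠ k, ‖a * P.coeff i‖ < ‖a * P.coeff k‖ := fun i hi => by
        rw [norm_mul, norm_mul]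
        exact mul_lt_mul_of_pos_left (hk i hi) (by linarith)
      have hdom : ‖((X - C a) * P).coeff k‖ = ‖a * P.coeff k‖ := by
        rcases k with _ | k
        · rw [hzero, norm_neg]
        · rw [hsucc, sub_eq_add_neg, IsUltrametricDist.norm_add_eq_max_of_norm_ne_norm, norm_neg,
            max_eq_right (hlt _).le]
          rw [norm_neg]
          exact (hlt _).ne
      refine ⟨k, fun i hi => ?_⟩
      rw [hdom]
      rcases i with _ | i
      · rw [hzero, norm_neg]
        exact hmul 0 hi
      · rw [hsucc]
        exact (hsub _ _).trans_lt (max_lt (hlt i) (hmul _ hi))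

/-- Without roots of norm one, a single coefficient would strictly dominate all others, but two
coefficients share the maximal norm `1`. -/
theorem exists_root_norm_eq_one [IsAlgClosed K] (P : K[X]) (hP : ∀ k, ‖P.coeff k‖ ≤ 1) {i j : ℕ}
    (hij : i ≠ j) (hi : ‖P.coeff i‖ = 1) (hj : ‖P.coeff j‖ = 1) :
    ∃ z : K, ‖z‖ = 1 ∧ P.eval z = 0 := by
  by_contra! hno
  have hP0 : P ≠ 0 := by
    rintro rfl
    simp at hi
  obtain ⟨k, hk⟩ := exists_dominant_coeff P.roots fun a ha h =>
    hno a h (by simpa [hP0] using ha)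
  have hlt : ∀ l ≠ k, ‖P.coeff l‖ < ‖P.coeff k‖ := fun l hl => by
    rw [(IsAlgClosed.splits P).eq_prod_roots, coeff_C_mul, coeff_C_mul, norm_mul, norm_mul]
    exact mul_lt_mul_of_pos_left (hk l hl)
      (norm_pos_iff.mpr (leadingCoeff_ne_zero.mpr hP0))
  rcases eq_or_ne i k with rfl | hik
  · exact (hlt j hij.symm).ne (hj.trans hi.symm)
  · exact absurd (hlt i hik) (by rw [hi]; exact (hP k).not_gt)

end Roots

/-! ### Laurent polynomials without zeros on the torus -/

section Structure

open Polynomial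

/-- Take `e_i = M^i`. Each nonzero difference of exponents is the coefficient vector of a nonzero
polynomial in `M`, and some integer `M` is a root of none of these finitely many polynomials. -/
theorem exists_weight {d : ℕ} (S : Finset (Fin d → ℤ)) :
    ∃ e : Fin d → ℤ, Set.InjOn (fun ν : Fin d → ℤ => ∑ i, ν i * e i) S := by
  classical
  let q : (Fin d → ℤ) → ℤ[X] := fun δ => ∑ i, C (δ i) * X ^ (i : ℕ)
  have hcoeff : ∀ δ (i : Fin d), (q δ).coeff i = δ i := fun δ i => by
    simp [q, coeff_X_pow, Fin.val_inj]
  let T := (S ×ˢ S).filter fun a => a.1 ≠ a.2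
  have hQ : ∏ a ∈ T, q (a.1 - a.2) ≠ 0 := by
    refine Finset.prod_ne_zero_iff.mpr fun a ha h0 => (Finset.mem_filter.mp ha).2 ?_
    funext i
    have h := hcoeff (a.1 - a.2) i
    rw [h0, coeff_zero, Pi.sub_apply] at h
    exact (sub_eq_zero.mp h.symm)
  obtain ⟨M, hM⟩ : ∃ M : ℤ, (∏ a ∈ T, q (a.1 - a.2)).eval M ≠ 0 := by
    by_contra! h
    exact hQ (Polynomial.funext fun x => by simpa using h x)
  refine ⟨fun i => M ^ (i : ℕ), fun μ hμ ν hν h => ?_⟩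
  by_contra hne
  rw [eval_prod, Finset.prod_ne_zero_iff] at hM
  refine hM (μ, ν) (by simp [T, hne, Finset.mem_coe.mp hμ, Finset.mem_coe.mp hν]) ?_
  simp only at h
  simp [q, eval_finsetSum, sub_mul, h]

variable {p : ℕ} [Fact p.Prime]

/-- Restrict `F` to the curve `z ↦ (z^(e_i))`, with weights separating the exponents so that no
coefficients merge, and multiply by `z^B` to clear negative powers. The resulting `P` has two
coefficients of norm one, hence a root of norm one. -/
theorem exists_zero_mem_padicTorus {d : ℕ} (F : Laurent d) {μ ν : Fin d → ℤ} (hne : μ ≠ ν)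
    (hμ : ¬(p : ℤ) ∣ F.coeff μ) (hν : ¬(p : ℤ) ∣ F.coeff ν) :
    ∃ z ∈ padicTorus p d, laurentEval z F = 0 := by
  classical
  obtain ⟨e, he⟩ := exists_weight F.coeff.support
  let w : (Fin d → ℤ) → ℤ := fun ν => ∑ i, ν i * e i
  obtain ⟨B, hB⟩ : ∃ B : ℤ, ∀ ν ∈ F.coeff.support, 0 ≤ w ν + B := by
    obtain ⟨b, hb⟩ := (F.coeff.support.image w).bddBelow
    exact ⟨-b, fun ν hν => by
      have := hb (Finset.mem_coe.mpr (Finset.mem_image_of_mem w hν))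
      linarith⟩
  let idx : (Fin d → ℤ) → ℕ := fun ν => (w ν + B).toNat
  have hidx : ∀ ν ∈ F.coeff.support, (idx ν : ℤ) = w ν + B := fun ν hν =>
    Int.toNat_of_nonneg (hB ν hν)
  have hinj : ∀ μ ∈ F.coeff.support, ∀ ν ∈ F.coeff.support, idx μ = idx ν → μ = ν := by
    intro μ hμ ν hν h
    refine he hμ hν ?_
    have h1 := hidx μ hμ
    have h2 := hidx ν hν
    rw [h] at h1
    exact add_right_cancel (h1.symm.trans h2)
  let P : ℂ_[p][X] := ∑ ν ∈ F.coeff.support, C ((F.coeff ν : ℤ) : ℂ_[p]) * X ^ idx ν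
  have hcoeff : ∀ k, P.coeff k =
      ∑ ν ∈ F.coeff.support, if k = idx ν then ((F.coeff ν : ℤ) : ℂ_[p]) else 0 := fun k => by
    simp [P, coeff_X_pow]
  have hle : ∀ k, ‖P.coeff k‖ ≤ 1 := fun k => by
    rw [hcoeff]
    refine IsUltrametricDist.norm_sum_le_of_forall_le_of_nonneg zero_le_one fun ν _ => ?_
    split_ifs
    · exact norm_intCast_le_one p _
    · simp
  have hone : ∀ ν, ¬(p : ℤ) ∣ F.coeff ν → ν ∈ F.coeff.support ∧ ‖P.coeff (idx ν)‖ = 1 := by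
    intro ν hν
    have hs : ν ∈ F.coeff.support := Finsupp.mem_support_iff.mpr fun h => hν (h ▸ dvd_zero _)
    refine ⟨hs, ?_⟩
    rw [hcoeff, Finset.sum_eq_single ν]
    · rw [if_pos rfl, norm_intCast_eq p]
      refine le_antisymm (Padic.norm_int_le_one _) (not_lt.mp fun h => hν ?_)
      exact Padic.norm_intCast_lt_one_iff.mp h
    · intro τ hτ hτν
      exact if_neg fun h => hτν (hinj ν hs τ hτ h).symm
    · exact fun h => absurd hs h
  obtain ⟨hsμ, h1⟩ := hone μ hμ
  obtain ⟨hsν, h2⟩ := hone ν hν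
  obtain ⟨z, hz, hroot⟩ := exists_root_norm_eq_one P hle
    (fun h => hne (hinj μ hsμ ν hsν h)) h1 h2
  have hz0 : z ≠ 0 := norm_ne_zero_iff.mp (hz ▸ one_ne_zero)
  refine ⟨fun i => z ^ e i, fun i => by simp [hz], ?_⟩
  have hev : P.eval z = z ^ B * laurentEval (fun i => z ^ e i) F := by
    simp only [P, eval_finsetSum, eval_mul, eval_C, eval_pow, eval_X, laurentEval, Finset.mul_sum]
    refine Finset.sum_congr rfl fun ν hν => ?_
    have h3 : ∏ i, (z ^ e i) ^ ν i = z ^ w ν := by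
      have h4 : ∀ s : Finset (Fin d), ∏ i ∈ s, (z ^ e i) ^ ν i = z ^ ∑ i ∈ s, ν i * e i := by
        intro s
        induction s using Finset.induction_on with
        | empty => simp
        | insert a s ha ih =>
          rw [Finset.prod_insert ha, Finset.sum_insert ha, zpow_add₀ hz0, ih, mul_comm (ν a),
            zpow_mul]
      exact h4 _
    rw [h3, ← zpow_natCast, hidx ν hν, zpow_add₀ hz0]
    ring
  rw [hev] at hroot
  exact (mul_eq_zero.mp hroot).resolve_left (zpow_ne_zero _ hz0)

/-- A Laurent polynomial all of whose coefficients are divisible by `m` is a multiple of `m`. -/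
theorem exists_eq_zsmul {d : ℕ} (F : Laurent d) (m : ℤ) (h : ∀ ν, m ∣ F.coeff ν) :
    ∃ G : Laurent d, F = m • G ∧ ∀ ν, F.coeff ν = m * G.coeff ν := by
  have key : ∀ ν, F.coeff ν = m * (F.coeff ν / m) := fun ν => (Int.mul_ediv_cancel' (h ν)).symm
  refine ⟨AddMonoidAlgebra.ofCoeff (F.coeff.mapRange (· / m) (Int.zero_ediv m)), ?_, ?_⟩
  · ext ν
    rw [AddMonoidAlgebra.coeff_smul_apply]
    simpa only [AddMonoidAlgebra.coeff_ofCoeff, Finsupp.mapRange_apply, smul_eq_mul] using key ν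
  · intro ν
    simpa using key ν

/-- Remove the largest power of `p` dividing all coefficients. Some coefficient is then prime to
`p`, and a second one would produce a zero on the torus. -/
theorem exists_eq_of_forall_padicTorus {d : ℕ} (F : Laurent d)
    (hF : ∀ z ∈ padicTorus p d, laurentEval z F ≠ 0) :
    ∃ (k : ℕ) (c : ℤ) (α : Fin d → ℤ) (g : Laurent d), ¬(p : ℤ) ∣ c ∧
      F = ((p : ℤ) ^ k) • (AddMonoidAlgebra.single α c + (p : ℤ) • g) := by
  classical
  have hF0 : F.coeff.support.Nonempty := by
    rw [Finsupp.support_nonempty_iff]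
    intro h
    exact hF (fun _ => 1) (fun _ => by simp) (by simp [laurentEval, h])
  obtain ⟨α, hα, hmin⟩ := Finset.exists_min_image F.coeff.support
    (fun ν => padicValInt p (F.coeff ν)) hF0
  have hdvd : ∀ ν, (p : ℤ) ^ padicValInt p (F.coeff α) ∣ F.coeff ν := fun ν => by
    by_cases hν : ν ∈ F.coeff.support
    · exact (padicValInt_dvd_iff _ _).mpr (Or.inr (hmin ν hν))
    · rw [Finsupp.notMem_support_iff.mp hν]
      exact dvd_zero _
  obtain ⟨G, hG, hGc⟩ := exists_eq_zsmul F _ hdvd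
  set k := padicValInt p (F.coeff α)
  have hGα : ¬(p : ℤ) ∣ G.coeff α := by
    rintro ⟨q, hq⟩
    have h1 : (p : ℤ) ^ (k + 1) ∣ F.coeff α := ⟨q, by rw [hGc, hq]; ring⟩
    rcases (padicValInt_dvd_iff _ _).mp h1 with h | h
    · exact Finsupp.mem_support_iff.mp hα h
    · exact absurd h (Nat.not_succ_le_self k)
  have hGν : ∀ ν ≠ α, (p : ℤ) ∣ G.coeff ν := by
    intro ν hν
    by_contra h
    obtain ⟨z, hz, h0⟩ := exists_zero_mem_padicTorus G hν h hGα
    refine hF z hz ?_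
    have hz0 : ∀ i, z i ≠ 0 := fun i => norm_ne_zero_iff.mp ((hz i).symm ▸ one_ne_zero)
    rw [← laurentHom_apply z hz0, hG, map_zsmul, laurentHom_apply, h0, smul_zero]
  obtain ⟨g, hg, -⟩ := exists_eq_zsmul (G.erase α) (p : ℤ) fun ν => by
    rcases eq_or_ne ν α with rfl | h
    · simp
    · simpa [h] using hGν ν h
  exact ⟨k, G.coeff α, α, g, hGα, by rw [← hg, AddMonoidAlgebra.single_add_erase, ← hG]⟩

end Structure

/-! ### Kernels of integral matrices on real tori -/

section TorusKernel

variable {I : Type*} [Fintype I] [DecidableEq I]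

open Matrix

/-- The kernel of an integral matrix on the torus `(ℝ/ℤ)^I`. -/
def torusKernel (A : Matrix I I ℤ) : AddSubgroup (I → UnitAddCircle) where
  carrier := {x | ∀ i, ∑ j, A i j • x j = 0}
  zero_mem' i := by simp
  add_mem' {x y} hx hy i := by
    simp only [Pi.add_apply, smul_add, Finset.sum_add_distrib, hx i, hy i, add_zero]
  neg_mem' {x} hx i := by
    simp only [Pi.neg_apply, smul_neg, Finset.sum_neg_distrib, hx i, neg_zero]

theorem natCard_quotient_range_mulVecLin (A : Matrix I I ℤ) (hA : A.det ≠ 0) :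
    Nat.card ((I → ℤ) ⧸ LinearMap.range A.mulVecLin) = A.det.natAbs := by
  have hinj : Function.Injective A.mulVecLin := Matrix.mulVec_injective_of_det_ne_zero hA
  have h := Submodule.natAbs_det_equiv (LinearMap.range A.mulVecLin)
    (LinearEquiv.ofInjective A.mulVecLin hinj)
  rw [← h]
  have h2 : ((LinearMap.range A.mulVecLin).subtype ∘ₗ AddMonoidHom.toIntLinearMap
      (LinearEquiv.ofInjective A.mulVecLin hinj : (I → ℤ) →+ LinearMap.range A.mulVecLin)) =
      Matrix.toLin' A := by
    ext x i
    rfl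
  rw [h2, LinearMap.det_toLin']

/-- The homomorphism `y ↦ A⁻¹ y` from `ℤ^I` to the torus. -/
def invMulVecHom (A : Matrix I I ℤ) : (I → ℤ) →+ (I → UnitAddCircle) where
  toFun y i := (((A.map (Int.cast : ℤ → ℝ))⁻¹ *ᵥ fun j => (y j : ℝ)) i : ℝ)
  map_zero' := by
    funext i
    simp [Matrix.mulVec, dotProduct]
  map_add' x y := by
    funext i
    simp [Matrix.mulVec, dotProduct, mul_add, Finset.sum_add_distrib]

theorem invMulVecHom_apply (A : Matrix I I ℤ) (y : I → ℤ) (i : I) :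
    invMulVecHom A y i =
      (((A.map (Int.cast : ℤ → ℝ))⁻¹ *ᵥ fun j => (y j : ℝ)) i : ℝ) := rfl

theorem isUnit_det_map_intCast {A : Matrix I I ℤ} (hA : A.det ≠ 0) :
    IsUnit (A.map (Int.cast : ℤ → ℝ)).det := by
  have h : (A.map (Int.cast : ℤ → ℝ)).det = (A.det : ℝ) :=
    ((Int.castRingHom ℝ).map_det A).symm
  rw [h]
  exact isUnit_iff_ne_zero.mpr (by exact_mod_cast hA)

omit [DecidableEq I] in
theorem intCast_mulVec (A : Matrix I I ℤ) (y : I → ℤ) :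
    (fun i => ((A *ᵥ y) i : ℝ)) = A.map (Int.cast : ℤ → ℝ) *ᵥ fun j => (y j : ℝ) := by
  funext i
  simp [Matrix.mulVec, dotProduct]

theorem ker_invMulVecHom {A : Matrix I I ℤ} (hA : A.det ≠ 0) :
    (invMulVecHom A).ker = (LinearMap.range A.mulVecLin).toAddSubgroup := by
  have hu := isUnit_det_map_intCast hA
  ext y
  rw [AddMonoidHom.mem_ker, Submodule.mem_toAddSubgroup, LinearMap.mem_range]
  constructor
  · intro h
    have h1 : ∀ i, ∃ m : ℤ, (m : ℝ) =
        ((A.map (Int.cast : ℤ → ℝ))⁻¹ *ᵥ fun j => (y j : ℝ)) i := fun i => by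
      have h2 := congrFun h i
      rw [invMulVecHom_apply] at h2
      obtain ⟨m, hm⟩ := (AddCircle.coe_eq_zero_iff _).mp h2
      exact ⟨m, by simpa using hm⟩
    choose m hm using h1
    refine ⟨m, ?_⟩
    have h3 : (fun i => ((A *ᵥ m) i : ℝ)) = fun i => (y i : ℝ) := by
      rw [intCast_mulVec, funext hm, Matrix.mulVec_mulVec, Matrix.mul_nonsing_inv _ hu,
        Matrix.one_mulVec]
    funext i
    exact_mod_cast congrFun h3 i
  · rintro ⟨m, rfl⟩
    funext i
    rw [invMulVecHom_apply, Matrix.mulVecLin_apply, intCast_mulVec, Matrix.mulVec_mulVec,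
      Matrix.nonsing_inv_mul _ hu, Matrix.one_mulVec]
    exact (AddCircle.coe_eq_zero_iff _).mpr ⟨m i, by simp⟩

theorem coe_mulVec (A : Matrix I I ℤ) (x : I → ℝ) (i : I) :
    (((A.map (Int.cast : ℤ → ℝ) *ᵥ x) i : ℝ) : UnitAddCircle) =
      ∑ j, A i j • (x j : UnitAddCircle) := by
  rw [Matrix.mulVec, dotProduct]
  have h : ∀ s : Finset I, ((∑ j ∈ s, (A.map (Int.cast : ℤ → ℝ)) i j * x j : ℝ) : UnitAddCircle) =
      ∑ j ∈ s, A i j • (x j : UnitAddCircle) := by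
    intro s
    induction s using Finset.induction_on with
    | empty => simp
    | insert a s ha ih =>
      rw [Finset.sum_insert ha, Finset.sum_insert ha, AddCircle.coe_add, ih, Matrix.map_apply,
        ← zsmul_eq_mul, AddCircle.coe_zsmul]
  exact h _

theorem range_invMulVecHom {A : Matrix I I ℤ} (hA : A.det ≠ 0) :
    (invMulVecHom A).range = torusKernel A := by
  have hu := isUnit_det_map_intCast hA
  ext x
  constructor
  · rintro ⟨y, rfl⟩ i
    simp only [invMulVecHom_apply]
    rw [← coe_mulVec, Matrix.mulVec_mulVec, Matrix.mul_nonsing_inv _ hu, Matrix.one_mulVec]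
    exact (AddCircle.coe_eq_zero_iff _).mpr ⟨y i, by simp⟩
  · intro hx
    have h1 : ∀ j, ∃ t : ℝ, (t : UnitAddCircle) = x j := fun j => QuotientAddGroup.mk_surjective _
    choose t ht using h1
    have h2 : ∀ i, ∃ m : ℤ, (m : ℝ) = (A.map (Int.cast : ℤ → ℝ) *ᵥ t) i := fun i => by
      have h3 := hx i
      simp only [← ht] at h3
      rw [← coe_mulVec] at h3
      obtain ⟨m, hm⟩ := (AddCircle.coe_eq_zero_iff _).mp h3
      exact ⟨m, by simpa using hm⟩
    choose m hm using h2
    refine ⟨m, ?_⟩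
    funext i
    rw [invMulVecHom_apply, funext hm, Matrix.mulVec_mulVec, Matrix.nonsing_inv_mul _ hu,
      Matrix.one_mulVec, ht]

/-- The map `y ↦ A⁻¹ y` identifies `ℤ^I / A ℤ^I` with the kernel, and the lattice `A ℤ^I` has index
`|det A|`. -/
theorem natCard_torusKernel {A : Matrix I I ℤ} (hA : A.det ≠ 0) :
    Nat.card (torusKernel A) = A.det.natAbs := by
  rw [← natCard_quotient_range_mulVecLin A hA, ← range_invMulVecHom hA]
  have h := Nat.card_congr (QuotientAddGroup.quotientKerEquivRange (invMulVecHom A)).toEquiv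
  rw [← h, ker_invMulVecHom hA]
  rfl

end TorusKernel

/-! ### The fixed points of `(nℤ)^d` -/

section FixedPoints

variable {d r : ℕ}

/-- Reduction of exponents modulo `n`. -/
def reduceMod (n : ℕ) (ν : Fin d → ℤ) : Fin d → ZMod n := fun i => (ν i : ZMod n)

theorem reduceMod_add (n : ℕ) (μ ν : Fin d → ℤ) :
    reduceMod n (μ + ν) = reduceMod n μ + reduceMod n ν := by
  funext i
  simp [reduceMod]

theorem reduceMod_surjective (n : ℕ) : Function.Surjective (reduceMod (d := d) n) := fun b => by
  choose ν hν using fun i => ZMod.intCast_surjective (b i)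
  exact ⟨ν, funext hν⟩

theorem mem_multiples_iff (n : ℕ) (γ : Fin d → ℤ) : γ ∈ multiples d n ↔ reduceMod n γ = 0 := by
  simp only [multiples, AddSubgroup.mem_pi, Set.mem_univ, true_imp_iff, Int.mem_zmultiples_iff,
    funext_iff, reduceMod, Pi.zero_apply, ZMod.intCast_zmod_eq_zero_iff_dvd]

variable (f : Matrix (Fin r) (Fin r) (Laurent d))

/-- The matrix describing multiplication by `f` on `n`-periodic points. -/
def periodicMatrix (n : ℕ) :
    Matrix (Fin r × (Fin d → ZMod n)) (Fin r × (Fin d → ZMod n)) ℤ :=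
  fun a b => ∑ ν ∈ (f a.1 b.1).coeff.support,
    if a.2 + reduceMod n ν = b.2 then (f a.1 b.1).coeff ν else 0

variable (n : ℕ) [NeZero n]

/-- The values lie in an arbitrary group `M` because this serves both circle-valued periodic points
and `K`-valued characters. -/
theorem sum_periodicMatrix_smul {M : Type*} [AddCommGroup M]
    (y : Fin r × (Fin d → ZMod n) → M) (j : Fin r) (a : Fin d → ZMod n) :
    ∑ b, periodicMatrix f n (j, a) b • y b =
      ∑ i, ∑ ν ∈ (f j i).coeff.support, (f j i).coeff ν • y (i, a + reduceMod n ν) := by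
  rw [Fintype.sum_prod_type]
  refine Finset.sum_congr rfl fun i _ => ?_
  simp only [periodicMatrix, Finset.sum_smul]
  rw [Finset.sum_comm]
  refine Finset.sum_congr rfl fun ν _ => ?_
  simp [ite_smul]

omit [NeZero n] in
theorem apply_eq_of_mem_fixedPoints
    (x : AddAction.fixedPoints (multiples d n) (solutions f)) {γ ν : Fin d → ℤ}
    (h : reduceMod n γ = reduceMod n ν) : (x.1 : FullShift d r) γ = (x.1 : FullShift d r) ν := by
  have hm : ν - γ ∈ multiples d n := by
    rw [mem_multiples_iff]
    have := reduceMod_add n (ν - γ) γ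
    rw [sub_add_cancel, h] at this
    simpa using this
  have h2 := congrArg (fun y : solutions f => (y : FullShift d r) ν) (x.2 ⟨ν - γ, hm⟩)
  rw [← h2]
  change _ = (x.1 : FullShift d r) (-(ν - γ) + ν)
  rw [neg_sub, sub_add_cancel]

/-- Periodic points of `X_f` correspond to the kernel of the periodic matrix. -/
def fixedPointsEquiv :
    AddAction.fixedPoints (multiples d n) (solutions f) ≃ torusKernel (periodicMatrix f n) where
  -- The representatives picked by `surjInv` are arbitrary; invariance under `(nℤ)^d` makes the
  -- value independent of them.
  toFun x := ⟨fun b => (x.1 : FullShift d r) (Function.surjInv (reduceMod_surjective n) b.2) b.1, by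
    rintro ⟨j, a⟩
    rw [sum_periodicMatrix_smul f n]
    rw [← x.1.2 (Function.surjInv (reduceMod_surjective n) a) j]
    refine Finset.sum_congr rfl fun i _ => Finset.sum_congr rfl fun ν _ => ?_
    have h := apply_eq_of_mem_fixedPoints f n x
      (γ := Function.surjInv (reduceMod_surjective n) (a + reduceMod n ν))
      (ν := Function.surjInv (reduceMod_surjective n) a + ν)
      (by rw [reduceMod_add, Function.surjInv_eq (reduceMod_surjective n),
        Function.surjInv_eq (reduceMod_surjective n)])
    exact congrArg (fun t => (f j i).coeff ν • t) (congrFun h i)⟩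
  invFun y := ⟨⟨fun γ i => y.1 (i, reduceMod n γ), fun γ j => by
      rw [← y.2 (j, reduceMod n γ), sum_periodicMatrix_smul f n]
      simp only [reduceMod_add]⟩, by
    rintro ⟨γ, hγ⟩
    refine Subtype.ext (funext fun δ => funext fun i => ?_)
    change y.1 (i, reduceMod n (-γ + δ)) = y.1 (i, reduceMod n δ)
    have h := reduceMod_add n γ (-γ + δ)
    rw [(mem_multiples_iff n γ).mp hγ, add_neg_cancel_left, zero_add] at h
    rw [h]⟩
  left_inv x := by
    refine Subtype.ext (Subtype.ext (funext fun γ => funext fun i => ?_))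
    exact congrFun (apply_eq_of_mem_fixedPoints f n x (Function.surjInv_eq _ _)) i
  right_inv y := by
    refine Subtype.ext (funext fun b => ?_)
    simp only [Function.surjInv_eq]

theorem index_multiples : (multiples d n).index = n ^ d := by
  let φ : (Fin d → ℤ) →+ (Fin d → ZMod n) :=
    AddMonoidHom.mk' (reduceMod n) (reduceMod_add n)
  have h : multiples d n = φ.ker := by
    ext γ
    exact mem_multiples_iff n γ
  rw [h, AddSubgroup.index_ker, AddMonoidHom.range_eq_top.mpr (reduceMod_surjective n),
    Nat.card_congr AddSubgroup.topEquiv.toEquiv]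
  simp

end FixedPoints

/-! ### The determinant of the periodic matrix -/

section PeriodicDet

variable {d r n : ℕ} [NeZero n] {K : Type*} [Field K] (ψ : AddChar (ZMod n) K)

/-- The point of `μ_n^d` attached to `c`. -/
def charPoint (c : Fin d → ZMod n) : Fin d → K := fun i => ψ (c i)

omit [NeZero n] in
theorem charPoint_ne_zero (c : Fin d → ZMod n) (i : Fin d) : charPoint ψ c i ≠ 0 :=
  (ψ.val_isUnit (c i)).ne_zero

/-- The character of `(ℤ/n)^d` attached to `c`. -/
def charProd (c b : Fin d → ZMod n) : K := ∏ i, ψ (b i * c i)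

omit [NeZero n] in
theorem charProd_add (c a b : Fin d → ZMod n) :
    charProd ψ c (a + b) = charProd ψ c a * charProd ψ c b := by
  simp [charProd, add_mul, AddChar.map_add_eq_mul, Finset.prod_mul_distrib]

omit [NeZero n] in
theorem prod_charPoint_zpow (c : Fin d → ZMod n) (ν : Fin d → ℤ) :
    ∏ i, charPoint ψ c i ^ ν i = charProd ψ c (reduceMod n ν) := by
  refine Finset.prod_congr rfl fun i _ => ?_
  rw [charPoint, ← AddChar.map_zsmul_eq_zpow, zsmul_eq_mul]
  rfl

theorem sum_charProd {ψ : AddChar (ZMod n) K} (hψ : ψ.IsPrimitive) (c : Fin d → ZMod n) :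
    ∑ b, charProd ψ c b = if c = 0 then (n : K) ^ d else 0 := by
  have h : ∑ b, charProd ψ c b = ∏ i, ∑ x, ψ (x * c i) := by
    rw [Finset.prod_univ_sum, Fintype.piFinset_univ]
    rfl
  rw [h]
  simp only [AddChar.sum_mulShift _ hψ, ZMod.card]
  split_ifs with hc
  · simp [hc]
  · obtain ⟨i, hi⟩ := Function.ne_iff.mp hc
    exact Finset.prod_eq_zero (Finset.mem_univ i) (by rw [if_neg (by simpa using hi), Nat.cast_zero])

-- Characters are eigenvectors of translations: with `X` the Fourier matrix of `(ℤ/n)^d` and `V = 1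
-- ⊗ X`, one has `A V = V D`, where `D` has the blocks `f(ζ)`. Orthogonality of characters and `n ≠
-- 0` in `K` make `V` invertible.
open Matrix in
theorem det_periodicMatrix {ψ : AddChar (ZMod n) K} (hψ : ψ.IsPrimitive) (hn : (n : K) ≠ 0)
    (f : Matrix (Fin r) (Fin r) (Laurent d)) :
    ((periodicMatrix f n).det : K) = ∏ c, laurentEval (charPoint ψ c) f.det := by
  let X : Matrix (Fin d → ZMod n) (Fin d → ZMod n) K := Matrix.of fun b c => charProd ψ c b
  let Y : Matrix (Fin d → ZMod n) (Fin d → ZMod n) K := Matrix.of fun c b => charProd ψ (-c) b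
  have hYX : Y * X = (n : K) ^ d • (1 : Matrix _ _ K) := by
    ext c c'
    have h : ∀ b, charProd ψ (-c) b * charProd ψ c' b = charProd ψ (c' - c) b := fun b => by
      rw [charProd, charProd, charProd, ← Finset.prod_mul_distrib]
      refine Finset.prod_congr rfl fun i _ => ?_
      rw [← AddChar.map_add_eq_mul]
      congr 1
      simp
      ring
    simp only [X, Y, Matrix.mul_apply, Matrix.of_apply, h, sum_charProd hψ, Matrix.smul_apply,
      Matrix.one_apply, sub_eq_zero, eq_comm (a := c'), smul_eq_mul, mul_ite, mul_one, mul_zero]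
  have hX : X.det ≠ 0 := fun h => by
    have h2 := congrArg Matrix.det hYX
    rw [Matrix.det_mul, h, mul_zero, Matrix.det_smul, Matrix.det_one, mul_one] at h2
    exact pow_ne_zero _ (pow_ne_zero _ hn) h2.symm
  let V : Matrix (Fin r × (Fin d → ZMod n)) (Fin r × (Fin d → ZMod n)) K :=
    kronecker (1 : Matrix (Fin r) (Fin r) K) X
  have hV : V.det ≠ 0 := by
    change (kroneckerMap (· * ·) (1 : Matrix (Fin r) (Fin r) K) X).det ≠ 0
    rw [Matrix.det_kronecker, Matrix.det_one, one_pow, one_mul]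
    exact pow_ne_zero _ hX
  let D := Matrix.blockDiagonal fun c : Fin d → ZMod n => f.map (laurentEval (charPoint ψ c))
  have hD : D.det = ∏ c, laurentEval (charPoint ψ c) f.det := by
    rw [Matrix.det_blockDiagonal]
    exact Finset.prod_congr rfl fun c _ => det_map_laurentEval f _ (charPoint_ne_zero ψ c)
  have hAV : (periodicMatrix f n).map (Int.cast : ℤ → K) * V = V * D := by
    ext ⟨j, a⟩ ⟨i, c⟩
    have h1 : (V * D) (j, a) (i, c) =
        charProd ψ c a * laurentEval (charPoint ψ c) (f j i) := by
      simp [V, D, X, Matrix.mul_apply, Fintype.sum_prod_type, Matrix.blockDiagonal_apply,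
        Matrix.one_apply]
    have h2 : ((periodicMatrix f n).map (Int.cast : ℤ → K) * V) (j, a) (i, c) =
        ∑ b, periodicMatrix f n (j, a) b • V b (i, c) := by
      simp [Matrix.mul_apply, zsmul_eq_mul]
    rw [h1, h2, sum_periodicMatrix_smul]
    simp only [V, X, kronecker, Matrix.kroneckerMap_apply, Matrix.one_apply, Matrix.of_apply,
      ite_mul, one_mul, zero_mul, smul_ite, smul_zero]
    rw [Finset.sum_eq_single i (fun k _ hk => by simp [hk]) (by simp)]
    simp only [if_true, charProd_add, laurentEval, Finset.mul_sum, prod_charPoint_zpow, zsmul_eq_mul]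
    exact Finset.sum_congr rfl fun ν _ => by ring
  have hA : ((periodicMatrix f n).map (Int.cast : ℤ → K)).det = ((periodicMatrix f n).det : K) :=
    ((Int.castRingHom K).map_det _).symm
  rw [← hA, ← hD]
  refine mul_right_cancel₀ hV ?_
  rw [← Matrix.det_mul, hAV, Matrix.det_mul, mul_comm]

theorem injective_of_isPrimitive {ψ : AddChar (ZMod n) K} (hψ : ψ.IsPrimitive) :
    Function.Injective ψ := by
  intro a b h
  rw [← sub_eq_zero, ← hψ.zmod_char_eq_one_iff n, AddChar.map_sub_eq_div, h,
    div_self (ψ.val_isUnit b).ne_zero]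

omit [NeZero n] in
theorem pow_eq_one_of_addChar (ψ : AddChar (ZMod n) K) (a : ZMod n) : ψ a ^ n = 1 := by
  rw [← AddChar.map_nsmul_eq_pow]
  simp

open Classical in
theorem image_addChar_eq_nthRootsFinset {ψ : AddChar (ZMod n) K}
    (hψ : ψ.IsPrimitive) :
    Finset.univ.image ψ = Polynomial.nthRootsFinset n (1 : K) := by
  refine Finset.eq_of_subset_of_card_le (fun z hz => ?_) ?_
  · obtain ⟨a, -, rfl⟩ := Finset.mem_image.mp hz
    exact (Polynomial.mem_nthRootsFinset (NeZero.pos n) 1).mpr (pow_eq_one_of_addChar ψ a)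
  · rw [Finset.card_image_of_injective _ (injective_of_isPrimitive hψ), Finset.card_univ,
      ZMod.card]
    exact (Multiset.toFinset_card_le _).trans (Polynomial.card_nthRoots n 1)

theorem sum_piFinset_nthRootsFinset {ψ : AddChar (ZMod n) K} (hψ : ψ.IsPrimitive) {M : Type*}
    [AddCommMonoid M] (F : (Fin d → K) → M) :
    ∑ ζ ∈ Fintype.piFinset fun _ : Fin d => Polynomial.nthRootsFinset n (1 : K), F ζ =
      ∑ c, F (charPoint ψ c) := by
  classical
  symm
  refine Finset.sum_nbij (charPoint ψ) (fun c _ => ?_) (fun c _ c' _ h => ?_) (fun ζ hζ => ?_)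
    fun c _ => rfl
  · rw [Fintype.mem_piFinset]
    intro i
    exact (Polynomial.mem_nthRootsFinset (NeZero.pos n) 1).mpr (pow_eq_one_of_addChar ψ _)
  · exact funext fun i => injective_of_isPrimitive hψ (congrFun h i)
  · rw [Finset.mem_coe, Fintype.mem_piFinset] at hζ
    have hζ : ∀ i, ∃ a, ψ a = ζ i := fun i => by
      simpa [← image_addChar_eq_nthRootsFinset hψ] using hζ i
    choose c hc using hζ
    exact ⟨c, by simp, funext hc⟩

end PeriodicDet

/-! ### Averages over roots of unity -/

section Average

variable {d : ℕ}

theorem tendsto_coe_coprime_atTop (p : ℕ) [Fact p.Prime] :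
    Tendsto (fun n : {n : ℕ // n.Coprime p} => (n : ℕ)) atTop atTop := by
  have : Nonempty {n : ℕ // n.Coprime p} := ⟨⟨1, Nat.coprime_one_left p⟩⟩
  -- `b * p + 1` is prime to `p` and at least `b`.
  refine tendsto_atTop_atTop.mpr fun b => ⟨⟨b * p + 1, by simp⟩, fun a ha => ?_⟩
  have h1 : b * p + 1 ≤ (a : ℕ) := ha
  have h2 : b ≤ b * p := Nat.le_mul_of_pos_right b (Fact.out : p.Prime).pos
  omega

theorem neZero_of_coprime {p n : ℕ} [Fact p.Prime] (h : n.Coprime p) : NeZero n :=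
  ⟨fun h0 => (Fact.out : p.Prime).ne_one ((Nat.coprime_zero_left p).mp (h0 ▸ h))⟩

theorem le_natAbs_of_mem_multiples {n : ℕ} {γ : Fin d → ℤ} {i : Fin d} (hi : γ i ≠ 0)
    (h : γ ∈ multiples d n) : n ≤ (γ i).natAbs := by
  have h1 := congrFun ((mem_multiples_iff n γ).mp h) i
  rw [reduceMod, Pi.zero_apply, ZMod.intCast_zmod_eq_zero_iff_dvd] at h1
  exact Nat.le_of_dvd (Int.natAbs_pos.mpr hi) (Int.natCast_dvd.mp h1)

/-- The mean value of a Laurent polynomial over the `n`-th roots of unity. -/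
def rootMean (n : ℕ) (g : Laurent d) : ℤ :=
  ∑ ν ∈ g.coeff.support, if reduceMod n ν = 0 then g.coeff ν else 0

/-- By orthogonality only exponents divisible by `n` survive. That the mean is an integer matters:
its `p`-adic norm is at most one, uniformly in `n`. -/
theorem sum_laurentEval_charPoint {n : ℕ} [NeZero n] {K : Type*} [Field K]
    {ψ : AddChar (ZMod n) K} (hψ : ψ.IsPrimitive) (g : Laurent d) :
    ∑ c, laurentEval (charPoint ψ c) g = (n : K) ^ d * (rootMean n g : K) := by
  have hsymm : ∀ c b : Fin d → ZMod n, charProd ψ c b = charProd ψ b c := fun c b => by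
    simp [charProd, mul_comm]
  simp only [laurentEval, rootMean, prod_charPoint_zpow]
  rw [Finset.sum_comm]
  push_cast
  rw [Finset.mul_sum]
  refine Finset.sum_congr rfl fun ν _ => ?_
  rw [← Finset.mul_sum]
  simp only [hsymm _ (reduceMod n ν), sum_charProd hψ]
  split_ifs <;> ring

/-- Once `n` exceeds the entries of the finitely many exponents in the support, only the constant
term is divisible by `n`. -/
theorem eventually_rootMean_eq (g : Laurent d) :
    ∀ᶠ n in atTop, rootMean n g = g.coeff 0 := by
  have h : ∀ᶠ n in atTop, ∀ ν ∈ g.coeff.support, ν ≠ 0 → reduceMod n ν ≠ 0 := by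
    rw [Finset.eventually_all]
    intro ν _
    by_cases hν : ν = 0
    · exact Eventually.of_forall fun n h => absurd hν h
    obtain ⟨i, hi⟩ := Function.ne_iff.mp hν
    filter_upwards [eventually_gt_atTop (ν i).natAbs] with n hn _ h0
    exact absurd (le_natAbs_of_mem_multiples hi ((mem_multiples_iff n ν).mpr h0)) hn.not_ge
  filter_upwards [h] with n hn
  rw [rootMean, Finset.sum_eq_single 0]
  · rw [if_pos]
    funext i
    simp [reduceMod]
  · intro ν hν h0
    exact if_neg (hn ν hν h0)
  · intro h0
    rw [Finsupp.notMem_support_iff.mp h0, ite_self]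

end Average

/-! ### Existence of the Mahler measure -/

section Mahler

variable {p d : ℕ} [Fact p.Prime]

theorem norm_eq_one_of_pow_eq_one {z : ℂ_[p]} {n : ℕ} (hn : n ≠ 0) (h : z ^ n = 1) : ‖z‖ = 1 := by
  refine (pow_eq_one_iff_of_nonneg (norm_nonneg z) hn).mp ?_
  rw [← norm_pow, h, norm_one]

theorem charPoint_mem_padicTorus {n : ℕ} [NeZero n] (ψ : AddChar (ZMod n) ℂ_[p])
    (c : Fin d → ZMod n) : charPoint ψ c ∈ padicTorus p d := fun i =>
  norm_eq_one_of_pow_eq_one (NeZero.ne n) (pow_eq_one_of_addChar ψ (c i))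

variable (p) in
theorem exists_isPrimitive_addChar (n : ℕ) [NeZero n] :
    ∃ ψ : AddChar (ZMod n) ℂ_[p], ψ.IsPrimitive := by
  have : NeZero (n : ℂ_[p]) := ⟨by exact_mod_cast NeZero.ne n⟩
  obtain ⟨ζ, hζ⟩ := HasEnoughRootsOfUnity.exists_primitiveRoot ℂ_[p] n
  exact ⟨_, AddChar.zmodChar_primitive_of_primitive_root n hζ⟩

theorem norm_laurentEval_le_one (z : Fin d → ℂ_[p]) (hz : z ∈ padicTorus p d) (g : Laurent d) :
    ‖laurentEval z g‖ ≤ 1 := by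
  refine IsUltrametricDist.norm_sum_le_of_forall_le_of_nonneg zero_le_one fun ν _ => ?_
  rw [norm_mul, norm_prod, Finset.prod_eq_one fun i _ => by rw [norm_zpow, hz i, one_zpow], mul_one]
  exact norm_intCast_le_one p _

theorem norm_prime_div_lt_one {c : ℤ} (hc : ¬(p : ℤ) ∣ c) : ‖(p : ℂ_[p]) / c‖ < 1 := by
  have h : ‖(c : ℂ_[p])‖ = 1 := by
    rw [norm_intCast_eq p]
    exact le_antisymm (Padic.norm_int_le_one _)
      (not_lt.mp fun h => hc (Padic.norm_intCast_lt_one_iff.mp h))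
  rw [norm_div, h, div_one]
  exact norm_prime_lt_one p _

variable {k : ℕ} {c : ℤ} {α : Fin d → ℤ} {g : Laurent d}

theorem laurentEval_factorization (hc : ¬(p : ℤ) ∣ c) {z : Fin d → ℂ_[p]}
    (hz : z ∈ padicTorus p d) :
    laurentEval z (((p : ℤ) ^ k) • (AddMonoidAlgebra.single α c + (p : ℤ) • g)) =
      (p : ℂ_[p]) ^ k * (c * ((∏ i, z i ^ α i) *
        (1 + p / c * laurentEval z (AddMonoidAlgebra.single (-α) 1 * g)))) := by
  have hz0 : ∀ i, z i ≠ 0 := fun i => norm_ne_zero_iff.mp ((hz i).symm ▸ one_ne_zero)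
  have hc0 : (c : ℂ_[p]) ≠ 0 := by
    exact_mod_cast fun h : c = 0 => hc (h ▸ dvd_zero _)
  have h0 : ∏ i, z i ^ α i ≠ 0 := Finset.prod_ne_zero_iff.mpr fun i _ => zpow_ne_zero _ (hz0 i)
  simp only [← laurentHom_apply z hz0]
  simp only [map_add, map_mul, laurentHom_single, Pi.neg_apply, zpow_neg,
    Finset.prod_inv_distrib, zsmul_eq_mul]
  simp only [map_pow, map_natCast, Int.cast_pow, Int.cast_natCast, Int.cast_one, one_mul]
  field_simp

theorem norm_prime_div_mul_laurentEval_lt_one (hc : ¬(p : ℤ) ∣ c) {z : Fin d → ℂ_[p]}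
    (hz : z ∈ padicTorus p d) (G : Laurent d) :
    ‖p / c * laurentEval z G‖ < 1 := by
  rw [norm_mul]
  exact mul_lt_one_of_nonneg_of_lt_one_left (norm_nonneg _) (norm_prime_div_lt_one hc)
    (norm_laurentEval_le_one z hz G)

/-- At a point of finite order the monomial `z^α` is a root of unity, so its logarithm vanishes, as
does that of `p^k`. -/
theorem padicLog_laurentEval (hc : ¬(p : ℤ) ∣ c) {z : Fin d → ℂ_[p]}
    {n : ℕ} (hn : 0 < n) (hzn : ∀ i, z i ^ n = 1) :
    HasLog p (laurentEval z (((p : ℤ) ^ k) • (AddMonoidAlgebra.single α c + (p : ℤ) • g))) ∧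
    padicLog p (laurentEval z (((p : ℤ) ^ k) • (AddMonoidAlgebra.single α c + (p : ℤ) • g))) =
      padicLog p (c : ℂ_[p]) +
        logSeries (1 + p / c * laurentEval z (AddMonoidAlgebra.single (-α) 1 * g)) := by
  have hz : z ∈ padicTorus p d := fun i => norm_eq_one_of_pow_eq_one hn.ne' (hzn i)
  rw [laurentEval_factorization hc hz]
  have h1 : HasLog p ((p : ℂ_[p]) ^ k) := ⟨_, _, logData_prime_pow p ℂ_[p] k⟩
  have h2 := hasLog_intCast ℂ_[p] hc
  have hα : (∏ i, z i ^ α i) ^ n = 1 := by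
    rw [← Finset.prod_pow]
    refine Finset.prod_eq_one fun i _ => ?_
    rw [← zpow_natCast, zpow_comm, zpow_natCast, hzn, one_zpow]
  have h3 : HasLog p (∏ i, z i ^ α i) := hasLog_of_pow_eq_one hn hα
  have h4 : ‖1 + p / c * laurentEval z (AddMonoidAlgebra.single (-α) 1 * g) - 1‖ < 1 := by
    rw [add_sub_cancel_left]
    exact norm_prime_div_mul_laurentEval_lt_one hc hz _
  have h5 : HasLog p (1 + p / c * laurentEval z (AddMonoidAlgebra.single (-α) 1 * g)) :=
    ⟨_, _, logData_of_norm_sub_one_lt h4⟩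
  refine ⟨h1.mul (h2.mul (h3.mul h5)), ?_⟩
  rw [h1.padicLog_mul (h2.mul (h3.mul h5)), h2.padicLog_mul (h3.mul h5), h3.padicLog_mul h5,
    padicLog_prime_pow, padicLog_of_pow_eq_one hn hα, padicLog_of_norm_sub_one_lt h4]
  ring

/-- The `k`-th term in the expansion of the mean value of a logarithm. -/
def meanTerm (q : ℂ_[p]) (k : ℕ) (t : ℤ) : ℂ_[p] := (-1) ^ k * q ^ (k + 1) * t / ((k : ℂ_[p]) + 1)

theorem norm_meanTerm_le (q : ℂ_[p]) (k : ℕ) (t : ℤ) :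
    ‖meanTerm q k t‖ ≤ ((k : ℝ) + 1) * ‖q‖ ^ (k + 1) := by
  refine (norm_div_succ_le p _ k).trans ?_
  gcongr
  rw [norm_mul, norm_mul, norm_pow, norm_pow, norm_neg, norm_one, one_pow, one_mul]
  exact mul_le_of_le_one_right (by positivity) (norm_intCast_le_one p _)

theorem sum_logSeries_charPoint {n : ℕ} [NeZero n] {ψ : AddChar (ZMod n) ℂ_[p]}
    (hψ : ψ.IsPrimitive) (hc : ¬(p : ℤ) ∣ c) (G : Laurent d) :
    ((n : ℂ_[p]) ^ d)⁻¹ * ∑ a, logSeries (1 + p / c * laurentEval (charPoint ψ a) G) =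
      ∑' k, meanTerm (p / c) k (rootMean n (G ^ (k + 1))) := by
  have hn : (n : ℂ_[p]) ^ d ≠ 0 := pow_ne_zero _ (by exact_mod_cast NeZero.ne n)
  simp only [logSeries, add_sub_cancel_left]
  rw [← Summable.tsum_finsetSum, ← tsum_mul_left]
  · refine tsum_congr fun k => ?_
    have h := sum_laurentEval_charPoint hψ (G ^ (k + 1))
    have h2 : ∀ a, laurentEval (charPoint ψ a) (G ^ (k + 1)) =
        laurentEval (charPoint ψ a) G ^ (k + 1) := fun a => by
      rw [← laurentHom_apply _ (charPoint_ne_zero ψ a), map_pow, laurentHom_apply]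
    simp only [h2] at h
    rw [← Finset.sum_div, ← Finset.mul_sum]
    simp only [mul_pow]
    rw [← Finset.mul_sum, h, meanTerm]
    field_simp
  · intro a _
    have hlt := norm_prime_div_mul_laurentEval_lt_one hc (charPoint_mem_padicTorus ψ a) G
    refine Summable.of_norm_bounded (summable_succ_mul_pow (norm_nonneg _) hlt) fun k => ?_
    refine (norm_div_succ_le p _ k).trans ?_
    simp

/-- Dominated convergence: each term is eventually constant in `n`, and the bound `(k + 1)
‖p/c‖^(k+1)` does not involve `n`. -/
theorem tendsto_tsum_meanTerm (hc : ¬(p : ℤ) ∣ c) (G : Laurent d) :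
    Tendsto (fun n : {n : ℕ // n.Coprime p} =>
      ∑' k, meanTerm (p / c : ℂ_[p]) k (rootMean n (G ^ (k + 1)))) atTop
      (𝓝 (∑' k, meanTerm (p / c : ℂ_[p]) k ((G ^ (k + 1)).coeff 0))) := by
  refine tendsto_tsum_of_dominated_convergence
    (summable_succ_mul_pow (norm_nonneg (p / c : ℂ_[p])) (norm_prime_div_lt_one hc)) (fun k => ?_)
    (Eventually.of_forall fun n k => norm_meanTerm_le _ k _)
  refine tendsto_const_nhds.congr' ?_
  filter_upwards [(tendsto_coe_coprime_atTop p).eventually (eventually_rootMean_eq (G ^ (k + 1)))]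
    with n hn
  rw [hn]

theorem exists_hasPadicMahlerMeasure (F : Laurent d)
    (hF : ∀ z ∈ padicTorus p d, laurentEval z F ≠ 0) :
    ∃ L : ℂ_[p], HasPadicMahlerMeasure p F L := by
  obtain ⟨k, c, α, g, hc, rfl⟩ := exists_eq_of_forall_padicTorus F hF
  set G : Laurent d := AddMonoidAlgebra.single (-α) 1 * g with hG
  refine ⟨padicLog p (c : ℂ_[p]) + ∑' k, meanTerm (p / c : ℂ_[p]) k ((G ^ (k + 1)).coeff 0), ?_⟩
  refine ((tendsto_tsum_meanTerm hc G).const_add (padicLog p (c : ℂ_[p]))).congr fun n => ?_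
  have := neZero_of_coprime n.2
  obtain ⟨ψ, hψ⟩ := exists_isPrimitive_addChar p (n : ℕ)
  have hn : ((n : ℕ) : ℂ_[p]) ^ d ≠ 0 := pow_ne_zero _ (by exact_mod_cast NeZero.ne (n : ℕ))
  rw [sum_piFinset_nthRootsFinset hψ]
  have h : ∀ a, padicLog p (laurentEval (charPoint ψ a)
      (((p : ℤ) ^ k) • (AddMonoidAlgebra.single α c + (p : ℤ) • g))) =
      padicLog p (c : ℂ_[p]) + logSeries (1 + p / c * laurentEval (charPoint ψ a) G) := fun a =>
    (padicLog_laurentEval hc (NeZero.pos (n : ℕ)) fun i => pow_eq_one_of_addChar ψ (a i)).2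
  simp only [h]
  rw [Finset.sum_add_distrib, mul_add, sum_logSeries_charPoint hψ hc, Finset.sum_const,
    Finset.card_univ, Fintype.card_pi]
  simp only [ZMod.card, Finset.prod_const, Finset.card_univ, Fintype.card_fin, nsmul_eq_mul,
    Nat.cast_pow]
  rw [inv_mul_cancel_left₀ hn]

theorem hasLog_laurentEval (F : Laurent d)
    (hF : ∀ z ∈ padicTorus p d, laurentEval z F ≠ 0) {z : Fin d → ℂ_[p]}
    {n : ℕ} (hn : 0 < n) (hzn : ∀ i, z i ^ n = 1) : HasLog p (laurentEval z F) := by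
  obtain ⟨k, c, α, g, hc, rfl⟩ := exists_eq_of_forall_padicTorus F hF
  exact (padicLog_laurentEval hc hn hzn).1

end Mahler

/-! ### Entropy and Mahler measure -/

section Entropy

variable {p d r : ℕ} [Fact p.Prime]

theorem tendsToTrivial_multiples :
    TendsToTrivial fun n : {n : ℕ // n.Coprime p} => multiples d n := by
  refine ⟨fun n => ⟨inferInstance, ⟨?_⟩⟩, fun γ hγ => ?_⟩
  · have := neZero_of_coprime n.2
    rw [index_multiples]
    exact pow_ne_zero _ (NeZero.ne _)
  · obtain ⟨i, hi⟩ := Function.ne_iff.mp hγ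
    refine Set.Finite.subset ((Set.finite_Iic (γ i).natAbs).preimage
      (Subtype.val_injective.injOn)) fun n hn => ?_
    exact le_natAbs_of_mem_multiples hi hn

variable (f : Matrix (Fin r) (Fin r) (Laurent d))

theorem finite_and_ncard_fixedPoints {n : ℕ} [NeZero n] (h : (periodicMatrix f n).det ≠ 0) :
    (AddAction.fixedPoints (multiples d n) (solutions f)).Finite ∧
    (AddAction.fixedPoints (multiples d n) (solutions f)).ncard =
      (periodicMatrix f n).det.natAbs := by
  have hcard : Nat.card (AddAction.fixedPoints (multiples d n) (solutions f)) =
      (periodicMatrix f n).det.natAbs := by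
    rw [Nat.card_congr (fixedPointsEquiv f n), natCard_torusKernel h]
  -- `Nat.card` is zero on infinite types, so a nonzero count proves finiteness.
  have : Finite (AddAction.fixedPoints (multiples d n) (solutions f)) :=
    Nat.finite_of_card_ne_zero (by rw [hcard]; exact Int.natAbs_ne_zero.mpr h)
  exact ⟨Set.toFinite _, hcard⟩

/-- The sign of the determinant is invisible to the logarithm, as `-1` is a root of unity. -/
theorem padicLog_natAbs {K : Type*} [NormedField K] [NormedAlgebra ℚ_[p] K] [CompleteSpace K]
    [IsUltrametricDist K] {m : ℤ} (hm : HasLog p (m : K)) :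
    HasLog p (m.natAbs : K) ∧ padicLog p (m.natAbs : K) = padicLog p (m : K) := by
  have hsq : (-1 : K) ^ 2 = 1 := by norm_num
  rcases Int.natAbs_eq m with h | h
  · have e : (m : K) = (m.natAbs : K) := by
      conv_lhs => rw [h]
      exact Int.cast_natCast _
    rw [← e]
    exact ⟨hm, rfl⟩
  · have e : ((m.natAbs : ℤ) : K) = -1 * (m : K) := by
      rw [show (m.natAbs : ℤ) = -m by omega, Int.cast_neg, neg_one_mul]
    rw [Int.cast_natCast] at e
    have h1 : HasLog p (-1 : K) := hasLog_of_pow_eq_one two_pos hsq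
    rw [e]
    exact ⟨h1.mul hm, by rw [h1.padicLog_mul hm, padicLog_of_pow_eq_one two_pos hsq, zero_add]⟩

theorem fixedPoints_and_padicLog_ncard
    (hf : ∀ z ∈ padicTorus p d, laurentEval z f.det ≠ 0) {n : ℕ} [NeZero n] :
    (AddAction.fixedPoints (multiples d n) (solutions f)).Finite ∧
    0 < (AddAction.fixedPoints (multiples d n) (solutions f)).ncard ∧
    algebraMap ℚ_[p] ℂ_[p] (((multiples d n).index : ℚ_[p])⁻¹ *
      padicLog p ((AddAction.fixedPoints (multiples d n) (solutions f)).ncard : ℚ_[p])) =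
      ((n : ℂ_[p]) ^ d)⁻¹ *
      ∑ ζ ∈ Fintype.piFinset fun _ : Fin d => Polynomial.nthRootsFinset n (1 : ℂ_[p]),
        padicLog p (laurentEval ζ f.det) := by
  obtain ⟨ψ, hψ⟩ := exists_isPrimitive_addChar p n
  have hdet := det_periodicMatrix hψ (by exact_mod_cast NeZero.ne n) f
  have hne : (periodicMatrix f n).det ≠ 0 := by
    intro h
    rw [h, Int.cast_zero] at hdet
    exact Finset.prod_ne_zero_iff.mpr
      (fun c _ => hf _ (charPoint_mem_padicTorus ψ c)) hdet.symm
  obtain ⟨hfin, hcard⟩ := finite_and_ncard_fixedPoints f hne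
  obtain ⟨hlog, hsum⟩ := padicLog_prod (p := p) Finset.univ
    (fun c : Fin d → ZMod n => laurentEval (charPoint ψ c) f.det)
    fun c _ => hasLog_laurentEval f.det hf (NeZero.pos n) fun i => pow_eq_one_of_addChar ψ (c i)
  rw [← hdet] at hlog hsum
  obtain ⟨hlog', hsum'⟩ := padicLog_natAbs hlog
  rw [← map_natCast (algebraMap ℚ_[p] ℂ_[p])] at hlog' hsum'
  have hlogQ := hasLog_of_hasLog_algebraMap ℂ_[p] hlog'
  refine ⟨hfin, by rw [hcard]; exact Int.natAbs_pos.mpr hne, ?_⟩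
  rw [hcard, sum_piFinset_nthRootsFinset hψ, ← hsum, ← hsum', hlogQ.padicLog_algebraMap ℂ_[p],
    index_multiples, map_mul, map_inv₀, map_natCast, Nat.cast_pow]

end Entropy

end PadicEntropy

end


theorem theorem3p2 (p : ℕ) [Fact p.Prime] (d r : ℕ)
    (f : Matrix (Fin r) (Fin r) (PadicEntropy.Laurent d))
    (hf : ∀ z ∈ PadicEntropy.padicTorus p d, IsUnit (f.map (PadicEntropy.laurentEval z))) :
    ∃ h : ℚ_[p],
      PadicEntropy.HasPadicEntropy p (PadicEntropy.solutions f)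
        (fun n : {n : ℕ // n.Coprime p} => PadicEntropy.multiples d n) h ∧
      PadicEntropy.HasPadicMahlerMeasure p f.det (algebraMap ℚ_[p] ℂ_[p] h) := by
  open PadicEntropy in
  have hdet : ∀ z ∈ padicTorus p d, laurentEval z f.det ≠ 0 := fun z hz => by
    have hz0 : ∀ i, z i ≠ 0 := fun i => norm_ne_zero_iff.mp ((hz i).symm ▸ one_ne_zero)
    rw [← det_map_laurentEval f z hz0]
    exact ((Matrix.isUnit_iff_isUnit_det _).mp (hf z hz)).ne_zero
  have key : ∀ n : {n : ℕ // n.Coprime p}, _ := fun n =>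
    haveI := neZero_of_coprime n.2
    fixedPoints_and_padicLog_ncard f hdet (n := n)
  obtain ⟨L, hL⟩ := exists_hasPadicMahlerMeasure f.det hdet
  -- By completeness `ℚ_p` is closed in `ℂ_p`. Every mean is the image of an entropy term in `ℚ_p`,
  -- so the limit descends to `ℚ_p`, and convergence descends with it.
  have hemb : IsClosedEmbedding (algebraMap ℚ_[p] ℂ_[p]) :=
    (algebraMap_isometry ℚ_[p] ℂ_[p]).isClosedEmbedding
  have : Nonempty {n : ℕ // n.Coprime p} := ⟨⟨1, Nat.coprime_one_left p⟩⟩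
  have hT := Tendsto.congr (fun n => (key n).2.2.symm) hL
  obtain ⟨h, rfl⟩ := hemb.isClosed_range.mem_of_tendsto hT
    (Eventually.of_forall fun n => Set.mem_range_self _)
  exact ⟨h, ⟨tendsToTrivial_multiples, fun n => (key n).1, fun n => (key n).2.1,
    hemb.isEmbedding.tendsto_nhds_iff.mpr hT⟩, hL⟩
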